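/- **Setting.** There are $M$ agents. Agent $i$ holds $\mathbf A^{(i)}\in\mathbb R^{N_i\times d}$ and $\mathbf b^{(i)}\in\mathbb R^{N_i}$ with $N_i\ge 1$, and has the local loss $\tilde{\mathcal L}(\theta;i)=\frac1{2N_i}\|\mathbf A^{(i)}\theta-\mathbf b^{(i)}\|^2$. Let $N=\sum_i N_i$, let $\mathbf A\neq 0$ and $\mathbf b$ be obtained by stacking the $\mathbf A^{(i)}$ and the $\mathbf b^{(i)}$, and let $\mathcal L(\theta)=\frac1{2N}\|\mathbf A\theta-\mathbf b\|^2$, $\mathcal L^\star=\inf_\theta\mathcal L(\theta)$. Let $\sigma_{\min}(\mathbf A)$ be the smallest non-zero singular value of $\mathbf A$ and $\sigma_{\max}$ the largest singular value of a matrix. A token moves over the agents along a time-homogeneous Markov chain $(Z_k)_{k\ge0}$ with transition matrix $p$ and arbitrary initial distribution. The unique invariant distribution of $p$ is $q=(N_1/N,\dots,N_M/N)$, and $t_{\rm mix}\in\{1,2,\dots\}$ is a mixing time: for all $k\ge 0$ and all $z$, $\tfrac12\sum_j|p^{(k)}(j\mid z)-q_j|\le 2^{-\lfloor k/t_{\rm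 mix}\rfloor}$. From a deterministic $\theta_0\in\mathbb R^d$ the iterates are $$\theta_{k+1}=\theta_k-\alpha_k\nabla\tilde{\mathcal L}(\theta_k;Z_k),\qquad \alpha_k=\frac{a}{k+K_0},\qquad a\ge \frac{2N}{\sigma_{\min}(\mathbf A)^2}.$$ Write $\Delta_k=\mathcal L(\theta_k)-\mathcal L^\star$. **Statement.** For all real $B,F,D,R$ there is a constant $C>0$, depending only on $B,F,D,R$, such that the following holds for every setting as above with $$\max_i \frac{2N\sigma_{\max}(\mathbf A^{(i)})^2}{N_i^2}\le B,\qquad \mathcal L^\star\le F,\qquad \Delta_0\le D,\qquad a\le R\,\frac{N}{\sigma_{\min}(\mathbf A)^2}.$$ Put $S=t_{\rm mix}^2N^2/\sigma_{\min}(\mathbf A)^4$. (a) There are a function $\mathfrak a_1:(0,1)\to\mathbb R$ and a $c>0$ with $$c\log\tfrac1\delta\ \le\ \mathfrak a_1(\delta)\ \le\ C\,S\,\log\!\big(2+\tfrac{S}{\delta}\big)\qquad\text{for all }\delta\in(0,1)$$ (in particular $\mathfrak a_1=\Omega(\log(1/\delta))$), such that for every $\delta\in(0,1)$ and every $K_0>\mathfrak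 a_1(\delta)$, with probability at least $1-\delta$, $$\Delta_k\ \le\ \frac{C}{k+K_0}\left(K_0\Delta_0+\frac{t_{\rm mix}^2N^2\log(2k/\delta)}{\sigma_{\min}(\mathbf A)^4}\right)\qquad\text{for all }k\in\{1,2,\dots\}\text{ simultaneously.}$$ (b) There is a constant $\mathfrak a_2$ with $0<\mathfrak a_2\le C\,t_{\rm mix}N^2/\sigma_{\min}(\mathbf A)^4$ such that for every $K_0>\mathfrak a_2$, $\Delta_k$ is integrable and $$\mathbb E[\Delta_k]\ \le\ \frac{C}{k+K_0}\left(K_0\Delta_0+\frac{t_{\rm mix}N^2}{\sigma_{\min}(\mathbf A)^4}\right)\qquad\text{for all }k\in\{1,2,\dots\}.$$ In particular, the suboptimality is $\mathcal O\big(t_{\rm mix}^2N^2\log(2k/\delta)/(\sigma_{\min}(\mathbf A)^4k)\big)$ for all $k$ with probability at least $1-\delta$, and $\mathcal O\big(t_{\rm mix}N^2/(\sigma_{\min}(\mathbf A)^4k)\big)$ in expectation, where the implied constants also depend on $K_0$, only through the term $K_0\Delta_0/(k+K_0)$. -/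

import Mathlib

open MeasureTheory

noncomputable section

namespace TokenSGD

/-- The largest singular value of a real matrix (singular values are listed in
decreasing order, starting at index `0`). -/
def sigmaMax {m n : Type*} [Fintype m] [Fintype n] [DecidableEq n] (A : Matrix m n ℝ) : ℝ :=
  (Matrix.toEuclideanLin A).singularValues 0

/-- The smallest non-zero singular value of a real (non-zero) matrix. -/
def sigmaMin {m n : Type*} [Fintype m] [Fintype n] [DecidableEq n] (A : Matrix m n ℝ) : ℝ :=
  sInf {s : ℝ | 0 < s ∧ ∃ i : ℕ, (Matrix.toEuclideanLin A).singularValues i = s}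

/-- The least squares objective `‖A θ - b‖² / (2 · #rows)`. -/
def lsLoss {m n : Type*} [Fintype m] [Fintype n] [DecidableEq n]
    (A : Matrix m n ℝ) (b : EuclideanSpace ℝ m) (θ : EuclideanSpace ℝ n) : ℝ :=
  1 / (2 * (Fintype.card m : ℝ)) * ‖Matrix.toEuclideanLin A θ - b‖ ^ 2

section Data

variable {M d : ℕ} {n : Fin M → ℕ}

/-- The global design matrix: the local design matrices stacked on top of each other.
Its rows are indexed by the pairs (agent, local sample). -/
def stackMatrix (A : ∀ i, Matrix (Fin (n i)) (Fin d) ℝ) :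
    Matrix (Σ i, Fin (n i)) (Fin d) ℝ :=
  Matrix.of fun r j => A r.1 r.2 j

/-- The global target vector: the local targets stacked on top of each other. -/
def stackVector (b : ∀ i, EuclideanSpace ℝ (Fin (n i))) :
    EuclideanSpace ℝ (Σ i, Fin (n i)) :=
  WithLp.toLp 2 fun r => b r.1 r.2

/-- The local objective `‖A⁽ⁱ⁾ θ - b⁽ⁱ⁾‖² / (2 Nᵢ)` of agent `i`. -/
def localLoss (A : ∀ i, Matrix (Fin (n i)) (Fin d) ℝ)
    (b : ∀ i, EuclideanSpace ℝ (Fin (n i))) (i : Fin M) (θ : EuclideanSpace ℝ (Fin d)) : ℝ :=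
  lsLoss (A i) (b i) θ

/-- The global objective `‖A θ - b‖² / (2 N)`, where `N = N₁ + ⋯ + N_M`. -/
def globalLoss (A : ∀ i, Matrix (Fin (n i)) (Fin d) ℝ)
    (b : ∀ i, EuclideanSpace ℝ (Fin (n i))) (θ : EuclideanSpace ℝ (Fin d)) : ℝ :=
  lsLoss (stackMatrix A) (stackVector b) θ

/-- The optimal value `inf L` of the global objective. -/
def optValue (A : ∀ i, Matrix (Fin (n i)) (Fin d) ℝ)
    (b : ∀ i, EuclideanSpace ℝ (Fin (n i))) : ℝ :=
  ⨅ θ : EuclideanSpace ℝ (Fin d), globalLoss A b θ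

/-- The suboptimality gap `L(θ) - inf L` of the global objective. -/
def gap (A : ∀ i, Matrix (Fin (n i)) (Fin d) ℝ)
    (b : ∀ i, EuclideanSpace ℝ (Fin (n i))) (θ : EuclideanSpace ℝ (Fin d)) : ℝ :=
  globalLoss A b θ - optValue A b

/-- The token iteration `θ_{k+1} = θ_k - α_k ∇L̃(θ_k; z_k)` along the node sequence `z`. -/
def iterate (A : ∀ i, Matrix (Fin (n i)) (Fin d) ℝ)
    (b : ∀ i, EuclideanSpace ℝ (Fin (n i))) (α : ℕ → ℝ) (θ₀ : EuclideanSpace ℝ (Fin d))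
    (z : ℕ → Fin M) : ℕ → EuclideanSpace ℝ (Fin d)
  | 0 => θ₀
  | k + 1 => iterate A b α θ₀ z k -
      α k • gradient (localLoss A b (z k)) (iterate A b α θ₀ z k)

/-- The distribution `q_i = N_i / N` on the agents. -/
def agentDist (n : Fin M → ℕ) (i : Fin M) : ℝ := (n i : ℝ) / ∑ j, (n j : ℝ)

end Data

section Chain

variable {M : ℕ}

/-- `q` is an invariant probability distribution of the transition matrix `P`. -/
def IsInvariant (P : Matrix (Fin M) (Fin M) ℝ) (q : Fin M → ℝ) : Prop :=
  q ∈ stdSimplex ℝ (Fin M) ∧ Matrix.vecMul q P = q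

/-- The total variation distance `sup_S |p(S) - q(S)| = (1/2) ∑ |p_j - q_j|`
of two probability distributions on a finite set. -/
def tvDist (p q : Fin M → ℝ) : ℝ := (1 / 2) * ∑ j, |p j - q j|

/-- `T ≥ 1` is a mixing time of `P` with respect to `q`: from every starting point, the
distance of the `k`-step distribution to `q` is at most `2 ^ (-⌊k / T⌋)`, for all `k ≥ 0`. -/
def IsMixingTime (P : Matrix (Fin M) (Fin M) ℝ) (q : Fin M → ℝ) (T : ℕ) : Prop :=
  1 ≤ T ∧ ∀ (k : ℕ) (z : Fin M), tvDist ((P ^ k) z) q ≤ (1 / 2 : ℝ) ^ (k / T)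

/-- `Z` is a time-homogeneous Markov chain with transition matrix `P` under `μ`
(with an arbitrary initial distribution). -/
def IsMarkovChain {Ω : Type*} [MeasurableSpace Ω] (μ : Measure Ω)
    (P : Matrix (Fin M) (Fin M) ℝ) (Z : ℕ → Ω → Fin M) : Prop :=
  (∀ k, Measurable (Z k)) ∧
  ∀ (k : ℕ) (z : ℕ → Fin M),
    μ.real {ω | ∀ i ≤ k + 1, Z i ω = z i} =
      μ.real {ω | ∀ i ≤ k, Z i ω = z i} * P (z k) (z (k + 1))

end Chain

end TokenSGD

end

/-!
The bounds come from one Lyapunov function along the token iteration, built from the gap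
`Δ = L - inf L` and a solution of the Poisson equation of the chain.

A step along a local gradient `g i` instead of the mean gradient `ḡ = ∑ q i • g i` makes an error
`f i = ⟪ḡ, g i - ḡ⟫` of first order in the step size, and under the Markov chain this error does
not have conditional mean zero. Its `q`-mean is zero, though. As the chain mixes, the kernel
`H = ∑ₖ (Pᵏ - 1 q)` converges, with absolute row sums at most `4 T` (`exists_poissonKernel`), and
`h = H f` satisfies `f = h - P h`. The function `W = Δ - α h + const * α` therefore absorbs the
error up to terms of second order in `α` and a martingale difference, while the
Polyak-Łojasiewicz inequality with constant `m = σ_min(A)² / N` contracts it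
(`IsGradientOracle.lyapunov_step_le`). For step sizes `a / s`, `s = k + K₀`, with `m a ≥ 2` and
`K₀` at least of order `T / m²`, one has `Δ ≤ 2 W` and
`W_{k+1} ≤ (1 - 3 / s) W_k + O(T a² / s²) + (a / s) ζ_{k+1}`, where `ζ` is a martingale difference.

In expectation `ζ` vanishes and the recursion gives `O(1 / s)`
(`IsGradientOracle.integral_gap_le`).

With high probability, one uses that `|ζ| ≤ 16 B T √(Δ (Δ + F))`. As long as the gap stays below a
constant, the variance of `ζ` is hence at most of order `T² W`, and by Hoeffding's lemma
`exp (η s W)` with `η` of order `1 / (a T)²` is a supermartingale up to factors `exp (1 / s)`,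
whose product is only polynomial in `k` (`IsGradientOracle.integral_exp_pathLyapunov_le`).
Markov's inequality at every time, with failure probabilities `δ / (k (k + 1))`, bounds `W`; and
if `K₀` is at least of order `S log (2 + S / δ)`, `S = T² / m²`, then this bound implies that the
gap stays below the constant, which closes the induction over `k`
(`IsGradientOracle.le_measureReal_gap_le`).

The least squares losses enter only through `isGradientOracle_leastSquares`.
-/

namespace TokenSGD

/-! ### Singular values and least squares -/

section SingularValues

variable {E G : Type*} [NormedAddCommGroup E] [InnerProductSpace ℝ E] [FiniteDimensional ℝ E]
  [NormedAddCommGroup G] [InnerProductSpace ℝ G] [FiniteDimensional ℝ G]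

open LinearMap Module

/-- In a basis of right singular vectors, `‖L x‖²` is diagonal. -/
theorem norm_sq_apply_eq_sum_singularValues (L : E →ₗ[ℝ] G) (x : E) :
    ‖L x‖ ^ 2 = ∑ i : Fin (finrank ℝ E), L.singularValues i ^ 2 *
      (L.isSymmetric_adjoint_comp_self.eigenvectorBasis rfl).repr x i ^ 2 := by
  set e := L.isSymmetric_adjoint_comp_self.eigenvectorBasis rfl with he
  have h1 : ‖L x‖ ^ 2 = inner ℝ ((adjoint L ∘ₗ L) x) x := by
    rw [comp_apply, adjoint_inner_left, real_inner_self_eq_norm_sq]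
  rw [h1, ← e.repr.inner_map_map, PiLp.inner_apply]
  refine Finset.sum_congr rfl fun i _ => ?_
  rw [he, L.isSymmetric_adjoint_comp_self.eigenvectorBasis_apply_self_apply rfl,
    L.sq_singularValues_fin rfl]
  simp only [RCLike.inner_apply, conj_trivial, RCLike.ofReal_real_eq_id, id_eq]
  ring

/-- In a basis of right singular vectors, `‖L* L x‖²` is diagonal. -/
theorem norm_sq_adjoint_apply_eq_sum_singularValues (L : E →ₗ[ℝ] G) (x : E) :
    ‖adjoint L (L x)‖ ^ 2 = ∑ i : Fin (finrank ℝ E), L.singularValues i ^ 4 *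
      (L.isSymmetric_adjoint_comp_self.eigenvectorBasis rfl).repr x i ^ 2 := by
  set e := L.isSymmetric_adjoint_comp_self.eigenvectorBasis rfl with he
  rw [← comp_apply, ← e.repr.norm_map, EuclideanSpace.norm_sq_eq]
  refine Finset.sum_congr rfl fun i _ => ?_
  rw [he, L.isSymmetric_adjoint_comp_self.eigenvectorBasis_apply_self_apply rfl,
    ← L.sq_singularValues_fin rfl]
  simp only [RCLike.ofReal_real_eq_id, id_eq, Real.norm_eq_abs, sq_abs]
  ring

theorem norm_apply_le_singularValues_zero (L : E →ₗ[ℝ] G) (x : E) :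
    ‖L x‖ ≤ L.singularValues 0 * ‖x‖ := by
  refine le_of_sq_le_sq ?_ (mul_nonneg (L.singularValues_nonneg 0) (norm_nonneg x))
  rw [norm_sq_apply_eq_sum_singularValues, mul_pow,
    ← (L.isSymmetric_adjoint_comp_self.eigenvectorBasis rfl).repr.norm_map,
    EuclideanSpace.norm_sq_eq, Finset.mul_sum]
  refine Finset.sum_le_sum fun i _ => ?_
  rw [Real.norm_eq_abs, sq_abs]
  gcongr
  · exact L.singularValues_nonneg _
  · exact L.singularValues_antitone (Nat.zero_le _)

/-- A bound on a linear map is a bound on its adjoint. -/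
theorem norm_sq_adjoint_le {L : E →ₗ[ℝ] G} {K : ℝ} (hK : 0 ≤ K)
    (h : ∀ x, ‖L x‖ ^ 2 ≤ K * ‖x‖ ^ 2) (y : G) :
    ‖adjoint L y‖ ^ 2 ≤ K * ‖y‖ ^ 2 := by
  set u := adjoint L y
  have h1 : ‖u‖ ^ 2 = inner ℝ y (L u) := by
    rw [← adjoint_inner_left, real_inner_self_eq_norm_sq]
  have h2 : ‖u‖ ^ 2 ≤ ‖y‖ * ‖L u‖ := h1 ▸ real_inner_le_norm _ _
  rcases (norm_nonneg u).eq_or_lt with h0 | h0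
  · rw [← h0, zero_pow two_ne_zero]
    positivity
  · have h3 := h u
    have h4 : (‖u‖ ^ 2) ^ 2 ≤ ‖y‖ ^ 2 * (K * ‖u‖ ^ 2) := by
      calc (‖u‖ ^ 2) ^ 2 ≤ (‖y‖ * ‖L u‖) ^ 2 := by gcongr
        _ = ‖y‖ ^ 2 * ‖L u‖ ^ 2 := by ring
        _ ≤ _ := by gcongr
    have h5 : 0 < ‖u‖ ^ 2 := by positivity
    nlinarith

/-- The normal equations are solvable: project `b` onto the range of `L`. -/
theorem exists_adjoint_apply_sub_eq_zero (L : E →ₗ[ℝ] G) (b : G) :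
    ∃ x, adjoint L (L x - b) = 0 := by
  obtain ⟨x, hx⟩ := (range L).starProjection_apply_mem b
  refine ⟨x, ext_inner_right ℝ fun y => ?_⟩
  have h := (range L).sub_starProjection_mem_orthogonal b
  rw [← hx] at h
  have h2 := (Submodule.mem_orthogonal' _ _).1 h (L y) ⟨y, rfl⟩
  rw [adjoint_inner_left, inner_zero_left, ← neg_sub, inner_neg_left, h2, neg_zero]

theorem norm_sq_apply_add_sub (L : E →ₗ[ℝ] G) (b : G) (x v : E) :
    ‖L (x + v) - b‖ ^ 2 =
      ‖L x - b‖ ^ 2 + 2 * inner ℝ (adjoint L (L x - b)) v + ‖L v‖ ^ 2 := by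
  rw [map_add, add_sub_right_comm, norm_add_sq_real, adjoint_inner_left]

end SingularValues

section MatrixSingularValues

variable {m n : Type*} [Fintype m] [Fintype n] [DecidableEq n] {A : Matrix m n ℝ}

theorem sigmaMin_mem (hA : A ≠ 0) :
    sigmaMin A ∈ {s : ℝ | 0 < s ∧ ∃ i : ℕ, (Matrix.toEuclideanLin A).singularValues i = s} := by
  refine Set.Nonempty.csInf_mem ?_ ?_
  · have h : (Matrix.toEuclideanLin A).singularValues ≠ 0 := by
      rw [Ne, LinearMap.singularValues_eq_zero_iff]
      simpa using hA
    obtain ⟨i, hi⟩ := Finsupp.ne_iff.1 h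
    exact ⟨_, (LinearMap.singularValues_pos_iff_ne_zero _ i).2 hi, i, rfl⟩
  · refine ((Matrix.toEuclideanLin A).singularValues.support.finite_toSet.image
      (Matrix.toEuclideanLin A).singularValues).subset ?_
    rintro s ⟨hs, i, rfl⟩
    exact ⟨i, Finset.mem_coe.2 (Finsupp.mem_support_iff.2 hs.ne'), rfl⟩

theorem sigmaMin_pos (hA : A ≠ 0) : 0 < sigmaMin A := (sigmaMin_mem hA).1

theorem sigmaMin_le {i : ℕ} (hi : (Matrix.toEuclideanLin A).singularValues i ≠ 0) :
    sigmaMin A ≤ (Matrix.toEuclideanLin A).singularValues i :=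
  csInf_le ⟨0, fun _ hs => hs.1.le⟩
    ⟨(LinearMap.singularValues_pos_iff_ne_zero _ i).2 hi, i, rfl⟩

/-- On the range of `A`, the transpose is bounded below by the smallest non-zero singular value. -/
theorem sigmaMin_sq_mul_le (hA : A ≠ 0) (x : EuclideanSpace ℝ n) :
    sigmaMin A ^ 2 * ‖Matrix.toEuclideanLin A x‖ ^ 2 ≤
      ‖LinearMap.adjoint (Matrix.toEuclideanLin A) (Matrix.toEuclideanLin A x)‖ ^ 2 := by
  rw [norm_sq_apply_eq_sum_singularValues, norm_sq_adjoint_apply_eq_sum_singularValues,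
    Finset.mul_sum]
  refine Finset.sum_le_sum fun i _ => ?_
  rw [← mul_assoc]
  refine mul_le_mul_of_nonneg_right ?_ (sq_nonneg _)
  by_cases hi : (Matrix.toEuclideanLin A).singularValues i = 0
  · simp [hi]
  · have h1 : sigmaMin A ^ 2 ≤ (Matrix.toEuclideanLin A).singularValues i ^ 2 :=
      pow_le_pow_left₀ (sigmaMin_pos hA).le (sigmaMin_le hi) 2
    calc _ ≤ (Matrix.toEuclideanLin A).singularValues i ^ 2 *
          (Matrix.toEuclideanLin A).singularValues i ^ 2 := by gcongr
      _ = _ := by ring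

theorem norm_sq_apply_le_sigmaMax (A : Matrix m n ℝ) (x : EuclideanSpace ℝ n) :
    ‖Matrix.toEuclideanLin A x‖ ^ 2 ≤ sigmaMax A ^ 2 * ‖x‖ ^ 2 := by
  rw [← mul_pow]
  exact pow_le_pow_left₀ (norm_nonneg _) (norm_apply_le_singularValues_zero _ x) 2

theorem hasGradientAt_lsLoss (A : Matrix m n ℝ) (b : EuclideanSpace ℝ m)
    (θ : EuclideanSpace ℝ n) :
    HasGradientAt (lsLoss A b) ((1 / (Fintype.card m : ℝ)) •
      LinearMap.adjoint (Matrix.toEuclideanLin A) (Matrix.toEuclideanLin A θ - b)) θ := by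
  rw [hasGradientAt_iff_hasFDerivAt]
  have h1 : HasFDerivAt (fun x => Matrix.toEuclideanLin A x - b)
      (LinearMap.toContinuousLinearMap (Matrix.toEuclideanLin A)) θ :=
    (LinearMap.toContinuousLinearMap (Matrix.toEuclideanLin A)).hasFDerivAt.sub_const b
  refine (h1.norm_sq.const_mul (1 / (2 * (Fintype.card m : ℝ)))).congr_fderiv ?_
  ext v
  simp [LinearMap.adjoint_inner_left]
  ring

end MatrixSingularValues

/-! ### Stacked least squares problems -/

section LeastSquares

variable {M d : ℕ} {n : Fin M → ℕ} (A : ∀ i, Matrix (Fin (n i)) (Fin d) ℝ)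
  (b : ∀ i, EuclideanSpace ℝ (Fin (n i)))

theorem toEuclideanLin_stackMatrix_apply (x : EuclideanSpace ℝ (Fin d))
    (r : Σ i, Fin (n i)) :
    Matrix.toEuclideanLin (stackMatrix A) x r = Matrix.toEuclideanLin (A r.1) x r.2 := by
  simp [Matrix.toLpLin_apply, Matrix.mulVec, dotProduct, stackMatrix]

theorem norm_sq_stackMatrix_apply (x : EuclideanSpace ℝ (Fin d)) :
    ‖Matrix.toEuclideanLin (stackMatrix A) x‖ ^ 2 =
      ∑ i, ‖Matrix.toEuclideanLin (A i) x‖ ^ 2 := by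
  simp only [EuclideanSpace.norm_sq_eq, Fintype.sum_sigma, toEuclideanLin_stackMatrix_apply]

theorem norm_sq_stackMatrix_sub (x : EuclideanSpace ℝ (Fin d)) :
    ‖Matrix.toEuclideanLin (stackMatrix A) x - stackVector b‖ ^ 2 =
      ∑ i, ‖Matrix.toEuclideanLin (A i) x - b i‖ ^ 2 := by
  simp only [EuclideanSpace.norm_sq_eq, Fintype.sum_sigma, PiLp.sub_apply,
    toEuclideanLin_stackMatrix_apply, stackVector]

theorem adjoint_stackMatrix (x : EuclideanSpace ℝ (Fin d)) :
    LinearMap.adjoint (Matrix.toEuclideanLin (stackMatrix A))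
        (Matrix.toEuclideanLin (stackMatrix A) x - stackVector b) =
      ∑ i, LinearMap.adjoint (Matrix.toEuclideanLin (A i))
        (Matrix.toEuclideanLin (A i) x - b i) := by
  refine ext_inner_right ℝ fun v => ?_
  simp only [sum_inner, LinearMap.adjoint_inner_left, PiLp.inner_apply, Fintype.sum_sigma,
    PiLp.sub_apply, toEuclideanLin_stackMatrix_apply, stackVector]

theorem card_sigma_fin : (Fintype.card (Σ i, Fin (n i)) : ℝ) = ∑ i, (n i : ℝ) := by
  simp

/-- The gap is the quadratic form of the Hessian around any solution of the normal equations. -/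
theorem exists_gap_eq : ∃ θs : EuclideanSpace ℝ (Fin d),
    (LinearMap.adjoint (Matrix.toEuclideanLin (stackMatrix A)))
      (Matrix.toEuclideanLin (stackMatrix A) θs - stackVector b) = 0 ∧
    ∀ θ, gap A b θ = 1 / (2 * ∑ i, (n i : ℝ)) *
      ‖Matrix.toEuclideanLin (stackMatrix A) (θ - θs)‖ ^ 2 := by
  obtain ⟨θs, hs⟩ := exists_adjoint_apply_sub_eq_zero
    (Matrix.toEuclideanLin (stackMatrix A)) (stackVector b)
  refine ⟨θs, hs, fun θ => ?_⟩
  have key : ∀ θ, globalLoss A b θ = globalLoss A b θs + 1 / (2 * ∑ i, (n i : ℝ)) *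
      ‖Matrix.toEuclideanLin (stackMatrix A) (θ - θs)‖ ^ 2 := fun θ => by
    have h := norm_sq_apply_add_sub (Matrix.toEuclideanLin (stackMatrix A)) (stackVector b)
      θs (θ - θs)
    rw [hs, inner_zero_left, add_sub_cancel] at h
    rw [globalLoss, globalLoss, lsLoss, lsLoss, card_sigma_fin, h]
    ring
  have hopt : optValue A b = globalLoss A b θs := by
    refine le_antisymm (ciInf_le ⟨globalLoss A b θs, ?_⟩ θs) (le_ciInf fun θ => ?_)
    · rintro _ ⟨θ, rfl⟩
      simp only
      rw [key θ]
      exact le_add_of_nonneg_right (by positivity)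
    · rw [key θ]
      exact le_add_of_nonneg_right (by positivity)
  rw [gap, hopt, key θ]
  ring

theorem optValue_nonneg : 0 ≤ optValue A b :=
  Real.iInf_nonneg fun θ => by rw [globalLoss, lsLoss]; positivity

theorem gradient_localLoss (i : Fin M) (θ : EuclideanSpace ℝ (Fin d)) :
    gradient (localLoss A b i) θ = (1 / (n i : ℝ)) •
      LinearMap.adjoint (Matrix.toEuclideanLin (A i))
        (Matrix.toEuclideanLin (A i) θ - b i) := by
  have h := (hasGradientAt_lsLoss (A i) (b i) θ).gradient
  rwa [Fintype.card_fin] at h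

end LeastSquares

section Oracle

variable {M : ℕ} {E : Type*} [NormedAddCommGroup E] [InnerProductSpace ℝ E]

/-- The `q`-average of the local gradients. -/
def meanField (q : Fin M → ℝ) (g : Fin M → E → E) (θ : E) : E := ∑ i, q i • g i θ

/-- The only properties of the losses that enter the convergence analysis: `Δ` is a smooth
suboptimality gap with gradient `meanField q g` that satisfies the Polyak-Łojasiewicz inequality
with constant `m`, and the local gradients `g i` are Lipschitz and grow at most like
`√(Δ + F)`. All smoothness constants are bounded by the same `B`. -/
structure IsGradientOracle (q : Fin M → ℝ) (Δ : E → ℝ) (g : Fin M → E → E) (B F m : ℝ) :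
    Prop where
  mem_simplex : q ∈ stdSimplex ℝ (Fin M)
  one_le : 1 ≤ B
  m_pos : 0 < m
  m_le : m ≤ B
  F_nonneg : 0 ≤ F
  gap_nonneg : ∀ θ, 0 ≤ Δ θ
  norm_sq_le : ∀ i θ, ‖g i θ‖ ^ 2 ≤ B * (Δ θ + F)
  mean_norm_sq_le : ∀ θ, ‖meanField q g θ‖ ^ 2 ≤ B * Δ θ
  pl : ∀ θ, 2 * m * Δ θ ≤ ‖meanField q g θ‖ ^ 2
  lipschitz : ∀ i θ θ', ‖g i θ - g i θ'‖ ≤ B * ‖θ - θ'‖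
  descent : ∀ θ v, Δ (θ + v) ≤ Δ θ + inner ℝ (meanField q g θ) v + B * ‖v‖ ^ 2

end Oracle

section LeastSquaresOracle

variable {M d : ℕ} {n : Fin M → ℕ} {A : ∀ i, Matrix (Fin (n i)) (Fin d) ℝ}
  {b : ∀ i, EuclideanSpace ℝ (Fin (n i))} {N B : ℝ}

theorem agentDist_mem_stdSimplex (hN : 0 < ∑ i, (n i : ℝ)) :
    agentDist n ∈ stdSimplex ℝ (Fin M) := by
  refine ⟨fun i => by rw [agentDist]; positivity, ?_⟩
  simp only [agentDist, ← Finset.sum_div]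
  exact div_self hN.ne'

theorem norm_sq_stackMatrix_apply_le (hN : N = ∑ i, (n i : ℝ)) (hN0 : 0 < N)
    (hn : ∀ i, 1 ≤ n i)
    (hB : ∀ i, 2 * N * sigmaMax (A i) ^ 2 / (n i : ℝ) ^ 2 ≤ B) (hB0 : 0 ≤ B)
    (x : EuclideanSpace ℝ (Fin d)) :
    ‖Matrix.toEuclideanLin (stackMatrix A) x‖ ^ 2 ≤ B * N / 2 * ‖x‖ ^ 2 := by
  have h1 : ∀ i, sigmaMax (A i) ^ 2 ≤ B / 2 * n i := fun i => by
    have hni : (1 : ℝ) ≤ n i := by exact_mod_cast hn i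
    have hle : (n i : ℝ) ≤ N := by
      rw [hN]
      exact Finset.single_le_sum (f := fun i => (n i : ℝ)) (fun j _ => by positivity)
        (Finset.mem_univ i)
    have h := hB i
    rw [div_le_iff₀ (by positivity)] at h
    have h3 : B * (n i : ℝ) ^ 2 ≤ B * n i * N := by
      rw [sq, ← mul_assoc]
      gcongr
    nlinarith
  rw [norm_sq_stackMatrix_apply]
  calc _ ≤ ∑ i, B / 2 * n i * ‖x‖ ^ 2 := Finset.sum_le_sum fun i _ =>
        (norm_sq_apply_le_sigmaMax _ _).trans (by gcongr; exact h1 i)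
    _ = _ := by
        rw [← Finset.sum_mul, ← Finset.mul_sum, ← hN]
        ring

/-- The least squares losses form a gradient oracle whose Polyak-Łojasiewicz constant is the
smallest non-zero eigenvalue `σ_min(A)² / N` of the Hessian. -/
theorem isGradientOracle_leastSquares {F : ℝ} (hn : ∀ i, 1 ≤ n i) (hA : stackMatrix A ≠ 0)
    (hN : N = ∑ i, (n i : ℝ))
    (hB : ∀ i, 2 * N * sigmaMax (A i) ^ 2 / (n i : ℝ) ^ 2 ≤ B) (hB1 : 1 ≤ B)
    (hF : optValue A b ≤ F) (hN0 : 0 < N) :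
    IsGradientOracle (agentDist n) (gap A b) (fun i => gradient (localLoss A b i)) B F
      (sigmaMin (stackMatrix A) ^ 2 / N) := by
  obtain ⟨θs, hs, hgap⟩ := exists_gap_eq A b
  rw [← hN] at hgap
  set L := Matrix.toEuclideanLin (stackMatrix A) with hL
  have hB0 : 0 ≤ B := by linarith
  have hLle : ∀ x, ‖L x‖ ^ 2 ≤ B * N / 2 * ‖x‖ ^ 2 :=
    norm_sq_stackMatrix_apply_le hN hN0 hn hB hB0
  have hLadj : ∀ y, ‖LinearMap.adjoint L y‖ ^ 2 ≤ B * N / 2 * ‖y‖ ^ 2 :=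
    norm_sq_adjoint_le (by positivity) hLle
  have hmean : ∀ θ, meanField (agentDist n) (fun i => gradient (localLoss A b i)) θ =
      (1 / N) • LinearMap.adjoint L (L (θ - θs)) := fun θ => by
    have h1 : LinearMap.adjoint L (L (θ - θs)) = LinearMap.adjoint L (L θ - stackVector b) := by
      rw [← sub_eq_zero, ← map_sub, map_sub L]
      rw [← neg_eq_zero, ← map_neg, ← hs]
      congr 1
      abel
    rw [h1, hL, adjoint_stackMatrix, Finset.smul_sum, meanField]
    refine Finset.sum_congr rfl fun i _ => ?_
    have hni : (n i : ℝ) ≠ 0 := by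
      have := hn i
      positivity
    rw [gradient_localLoss, smul_smul, agentDist, ← hN]
    congr 1
    field_simp
  have hgm : ∀ θ, ‖meanField (agentDist n) (fun i => gradient (localLoss A b i)) θ‖ ^ 2 =
      1 / N ^ 2 * ‖LinearMap.adjoint L (L (θ - θs))‖ ^ 2 := fun θ => by
    rw [hmean, norm_smul, mul_pow, Real.norm_eq_abs, sq_abs, div_pow, one_pow]
  have hσ := sigmaMin_pos hA
  have hnpos : ∀ i, (0 : ℝ) < n i := fun i => by exact_mod_cast hn i
  refine ⟨agentDist_mem_stdSimplex (hN ▸ hN0), hB1, by positivity, ?_,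
    (optValue_nonneg A b).trans hF, ?_, ?_, ?_, ?_, ?_, ?_⟩
  · obtain ⟨x, hx⟩ : ∃ x, L x ≠ 0 := by
      by_contra! h
      exact hA ((Matrix.toEuclideanLin).map_eq_zero_iff.1 (LinearMap.ext h))
    have h1 := (sigmaMin_sq_mul_le hA x).trans (hLadj (L x))
    have h2 : 0 < ‖L x‖ ^ 2 := by positivity
    -- `σ_min² ‖L x‖² ≤ ‖L* L x‖² ≤ (B N / 2) ‖L x‖²`
    have h3 := le_of_mul_le_mul_right h1 h2
    rw [div_le_iff₀ hN0]
    nlinarith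
  · intro θ
    rw [hgap]
    positivity
  · intro i θ
    rw [gradient_localLoss, norm_smul, mul_pow, Real.norm_eq_abs, sq_abs, div_pow, one_pow]
    have h1 := norm_sq_adjoint_le (sq_nonneg _) (norm_sq_apply_le_sigmaMax (A i))
      (Matrix.toEuclideanLin (A i) θ - b i)
    have h2 : ‖Matrix.toEuclideanLin (A i) θ - b i‖ ^ 2 ≤ 2 * N * globalLoss A b θ := by
      rw [globalLoss, lsLoss, card_sigma_fin, ← hN, norm_sq_stackMatrix_sub]
      rw [← mul_assoc, mul_one_div_cancel (by positivity), one_mul]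
      exact Finset.single_le_sum
        (f := fun i => ‖Matrix.toEuclideanLin (A i) θ - b i‖ ^ 2)
        (fun j _ => by positivity) (Finset.mem_univ i)
    have h3 : 0 ≤ globalLoss A b θ := by rw [globalLoss, lsLoss]; positivity
    have h4 : globalLoss A b θ ≤ gap A b θ + F := by rw [gap]; linarith
    have hni := hnpos i
    calc _ ≤ 1 / (n i : ℝ) ^ 2 * (sigmaMax (A i) ^ 2 * (2 * N * globalLoss A b θ)) := by
          gcongr
          exact h1.trans (by gcongr)
      _ = 2 * N * sigmaMax (A i) ^ 2 / (n i : ℝ) ^ 2 * globalLoss A b θ := by ring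
      _ ≤ B * globalLoss A b θ := by gcongr; exact hB i
      _ ≤ _ := by gcongr
  · intro θ
    rw [hgm, hgap]
    calc _ ≤ 1 / N ^ 2 * (B * N / 2 * ‖L (θ - θs)‖ ^ 2) := by gcongr; exact hLadj _
      _ = _ := by field_simp
  · intro θ
    rw [hgm, hgap]
    calc _ = 1 / N ^ 2 * (sigmaMin (stackMatrix A) ^ 2 * ‖L (θ - θs)‖ ^ 2) := by field_simp
      _ ≤ _ := by gcongr; exact sigmaMin_sq_mul_le hA _
  · intro i θ θ'
    have hni := hnpos i
    rw [gradient_localLoss, gradient_localLoss, ← smul_sub, ← map_sub, sub_sub_sub_cancel_right,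
      ← map_sub]
    refine le_of_sq_le_sq ?_ (by positivity)
    rw [norm_smul, mul_pow, mul_pow, Real.norm_eq_abs, sq_abs, div_pow, one_pow]
    have h1 := norm_sq_adjoint_le (sq_nonneg _) (norm_sq_apply_le_sigmaMax (A i))
      (Matrix.toEuclideanLin (A i) (θ - θ'))
    -- the hypothesis on `B` also bounds the smoothness constant `σ_max(Aᵢ)² / Nᵢ` by `B`
    have hs1 : sigmaMax (A i) ^ 2 ≤ B * n i := by
      have h := hB i
      rw [div_le_iff₀ (by positivity)] at h
      have hle : (n i : ℝ) ≤ N := by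
        rw [hN]
        exact Finset.single_le_sum (f := fun i => (n i : ℝ)) (fun j _ => by positivity)
          (Finset.mem_univ i)
      have h3 : B * (n i : ℝ) ^ 2 ≤ B * n i * N := by
        rw [sq, ← mul_assoc]
        gcongr
      have h4 : N * (sigmaMax (A i) ^ 2) ≤ N * (B * n i) := by
        nlinarith [sq_nonneg (sigmaMax (A i))]
      exact le_of_mul_le_mul_left h4 hN0
    calc _ ≤ 1 / (n i : ℝ) ^ 2 * (sigmaMax (A i) ^ 2 * (sigmaMax (A i) ^ 2 * ‖θ - θ'‖ ^ 2)) := by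
          gcongr
          refine h1.trans ?_
          gcongr
          exact norm_sq_apply_le_sigmaMax _ _
      _ ≤ 1 / (n i : ℝ) ^ 2 * (B * n i * (B * n i * ‖θ - θ'‖ ^ 2)) := by gcongr
      _ = _ := by field_simp
  · intro θ v
    have h := norm_sq_apply_add_sub L 0 (θ - θs) v
    rw [sub_zero, sub_zero] at h
    rw [hgap, hgap, hmean, inner_smul_left, add_sub_right_comm, h]
    have h1 : 1 / (2 * N) * ‖L v‖ ^ 2 ≤ B * ‖v‖ ^ 2 := by
      calc _ ≤ 1 / (2 * N) * (B * N / 2 * ‖v‖ ^ 2) := by gcongr; exact hLle v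
        _ = B / 4 * ‖v‖ ^ 2 := by field_simp; ring
        _ ≤ _ := by gcongr; linarith
    rw [conj_trivial]
    calc _ = 1 / (2 * N) * ‖L (θ - θs)‖ ^ 2 +
          1 / N * inner ℝ (LinearMap.adjoint L (L (θ - θs))) v + 1 / (2 * N) * ‖L v‖ ^ 2 := by
          field_simp
      _ ≤ _ := by gcongr

end LeastSquaresOracle

/-! ### The Poisson equation and the drift of the Lyapunov function -/

section PoissonKernel

theorem sum_range_half_pow_div_le {T : ℕ} (hT : 1 ≤ T) (m : ℕ) :
    ∑ k ∈ Finset.range m, (1 / 2 : ℝ) ^ (k / T) ≤ 2 * T := by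
  have hblock : ∀ l : ℕ, ∑ k ∈ Finset.range (T * l), (1 / 2 : ℝ) ^ (k / T) =
      T * ∑ k ∈ Finset.range l, (1 / 2 : ℝ) ^ k := fun l => by
    induction l with
    | zero => simp
    | succ l ih =>
      rw [Nat.mul_succ, Finset.sum_range_add, ih, Finset.sum_range_succ, mul_add]
      congr 1
      rw [Finset.sum_congr rfl (g := fun _ => (1 / 2 : ℝ) ^ l), Finset.sum_const,
        Finset.card_range, nsmul_eq_mul]
      intro k hk
      rw [Nat.mul_add_div (by omega), Nat.div_eq_of_lt (Finset.mem_range.1 hk), add_zero]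
  calc _ ≤ ∑ k ∈ Finset.range (T * m), (1 / 2 : ℝ) ^ (k / T) :=
        Finset.sum_le_sum_of_subset_of_nonneg
          (Finset.range_mono (Nat.le_mul_of_pos_left m hT)) fun _ _ _ => by positivity
    _ = T * ∑ k ∈ Finset.range m, (1 / 2 : ℝ) ^ k := hblock m
    _ ≤ T * 2 := by
        gcongr
        exact sum_geometric_two_le m
    _ = _ := mul_comm _ _

/-- A fundamental solution `H = ∑ₖ (Pᵏ - 1 q)` of the Poisson equation of a mixing chain: for `f`
of `q`-mean zero, `h = H f` solves `h - P h = f`, and `h` exceeds `f` by a factor `4 T` at most. -/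
theorem exists_poissonKernel {M : ℕ} {P : Matrix (Fin M) (Fin M) ℝ} {q : Fin M → ℝ} {T : ℕ}
    (hP : P ∈ Matrix.rowStochastic ℝ (Fin M)) (hT : IsMixingTime P q T) :
    ∃ H : Fin M → Fin M → ℝ, (∀ i, ∑ j, |H i j| ≤ 4 * T) ∧
      ∀ i j, H i j - ∑ l, P i l * H l j = (if i = j then 1 else 0) - q j := by
  obtain ⟨hT1, hmix⟩ := hT
  -- `u m = Pᵐ - 1 q` is summable in `m`, and `P u m = u (m + 1)`
  set u : ℕ → Fin M → Fin M → ℝ := fun m i j => (P ^ m) i j - q j with hu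
  have hb : ∀ m i, ∑ j, |u m i j| ≤ 2 * (1 / 2 : ℝ) ^ (m / T) := fun m i => by
    have h := hmix m i
    rw [tvDist] at h
    linarith
  have hbj : ∀ i j m, |u m i j| ≤ 2 * (1 / 2 : ℝ) ^ (m / T) := fun i j m =>
    (Finset.single_le_sum (f := fun j => |u m i j|) (fun _ _ => abs_nonneg _)
      (Finset.mem_univ j)).trans (hb m i)
  have hpart : ∀ n, ∑ m ∈ Finset.range n, 2 * (1 / 2 : ℝ) ^ (m / T) ≤ 4 * T := fun n => by
    rw [← Finset.mul_sum]
    linarith [sum_range_half_pow_div_le hT1 n]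
  have hsumm : Summable fun m : ℕ => 2 * (1 / 2 : ℝ) ^ (m / T) :=
    summable_of_sum_range_le (fun _ => by positivity) hpart
  have habs : ∀ i j, Summable fun m => |u m i j| := fun i j =>
    Summable.of_nonneg_of_le (fun _ => abs_nonneg _) (hbj i j) hsumm
  have hs : ∀ i j, Summable fun m => u m i j := fun i j => (habs i j).of_abs
  refine ⟨fun i j => ∑' m, u m i j, fun i => ?_, fun i j => ?_⟩
  · calc ∑ j, |∑' m, u m i j| ≤ ∑ j, ∑' m, |u m i j| :=
          Finset.sum_le_sum fun j _ => by
            simpa only [Real.norm_eq_abs] using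
              norm_tsum_le_tsum_norm (f := fun m => u m i j) (habs i j)
      _ = ∑' m, ∑ j, |u m i j| := (Summable.tsum_finsetSum fun j _ => habs i j).symm
      _ ≤ 4 * T := Real.tsum_le_of_sum_range_le (fun _ => Finset.sum_nonneg fun _ _ => abs_nonneg _)
          fun n => (Finset.sum_le_sum fun m _ => hb m i).trans (hpart n)
  · have h1 : ∑ l, P i l * ∑' m, u m l j = ∑' m, u (m + 1) i j := by
      simp_rw [← tsum_mul_left]
      rw [← Summable.tsum_finsetSum fun l _ => (hs l j).mul_left _]
      refine tsum_congr fun m => ?_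
      simp only [hu, mul_sub, Finset.sum_sub_distrib, ← Finset.sum_mul,
        Matrix.sum_row_of_mem_rowStochastic hP, one_mul, pow_succ' P, Matrix.mul_apply]
    rw [h1]
    beta_reduce
    rw [(hs i j).tsum_eq_zero_add]
    simp [hu, Matrix.one_apply]

end PoissonKernel

section Drift

variable {M : ℕ} {E : Type*} [NormedAddCommGroup E] [InnerProductSpace ℝ E]
  {q : Fin M → ℝ} {Δ : E → ℝ} {g : Fin M → E → E} {B F m : ℝ}

/-- The bias of the local gradient `g i` in the direction of the mean gradient. -/
def gradientBias (q : Fin M → ℝ) (g : Fin M → E → E) (i : Fin M) (θ : E) : ℝ :=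
  inner ℝ (meanField q g θ) (g i θ - meanField q g θ)

/-- The solution `H f` of the Poisson equation for the gradient bias `f`. -/
def poissonCorrector (q : Fin M → ℝ) (g : Fin M → E → E) (H : Fin M → Fin M → ℝ) (i : Fin M)
    (θ : E) : ℝ := ∑ j, H i j * gradientBias q g j θ

/-- The value at `θ` of the Lyapunov function when the token is at `i` and the step size is `α`.
The last summand makes it non-negative. -/
def lyapunov (q : Fin M → ℝ) (Δ : E → ℝ) (g : Fin M → E → E) (H : Fin M → Fin M → ℝ) (c : ℝ)
    (α : ℝ) (i : Fin M) (θ : E) : ℝ :=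
  Δ θ - α * poissonCorrector q g H i θ + α * c

theorem sum_mul_gradientBias (hq : q ∈ stdSimplex ℝ (Fin M)) (θ : E) :
    ∑ j, q j * gradientBias q g j θ = 0 := by
  have h : ∑ j, q j • (g j θ - meanField q g θ) = 0 := by
    simp only [smul_sub, Finset.sum_sub_distrib, ← Finset.sum_smul, hq.2, one_smul]
    exact sub_self _
  simp only [gradientBias, ← inner_smul_right, ← inner_sum, h, inner_zero_right]

/-- The one-step fluctuation of the corrector; a martingale difference along the chain. -/
def fluctuation (P : Matrix (Fin M) (Fin M) ℝ) (q : Fin M → ℝ) (g : Fin M → E → E)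
    (H : Fin M → Fin M → ℝ) (i j : Fin M) (θ : E) : ℝ :=
  ∑ l, P i l * poissonCorrector q g H l θ - poissonCorrector q g H j θ

theorem sum_mul_fluctuation {P : Matrix (Fin M) (Fin M) ℝ}
    (hP : P ∈ Matrix.rowStochastic ℝ (Fin M)) (H : Fin M → Fin M → ℝ) (i : Fin M) (θ : E) :
    ∑ j, P i j * fluctuation P q g H i j θ = 0 := by
  simp only [fluctuation, mul_sub, Finset.sum_sub_distrib, ← Finset.sum_mul,
    Matrix.sum_row_of_mem_rowStochastic hP, one_mul, sub_self]

theorem gradientBias_eq {P : Matrix (Fin M) (Fin M) ℝ} {H : Fin M → Fin M → ℝ}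
    (hq : q ∈ stdSimplex ℝ (Fin M))
    (hH : ∀ i j, H i j - ∑ l, P i l * H l j = (if i = j then 1 else 0) - q j) (i : Fin M) (θ : E) :
    poissonCorrector q g H i θ - ∑ l, P i l * poissonCorrector q g H l θ =
      gradientBias q g i θ := by
  have h1 : ∑ l, P i l * poissonCorrector q g H l θ =
      ∑ j, (∑ l, P i l * H l j) * gradientBias q g j θ := by
    simp only [poissonCorrector, Finset.mul_sum, Finset.sum_mul]
    rw [Finset.sum_comm]
    simp only [mul_assoc]
  rw [h1, poissonCorrector, ← Finset.sum_sub_distrib]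
  simp only [← sub_mul, hH]
  simp only [sub_mul, Finset.sum_sub_distrib, sum_mul_gradientBias hq, ite_mul, one_mul,
    zero_mul, Finset.sum_ite_eq, Finset.mem_univ, if_true, sub_zero]

theorem abs_sum_mul_le {H f : Fin M → ℝ} {K c : ℝ} (hH : ∑ j, |H j| ≤ K) (hc : 0 ≤ c)
    (hf : ∀ j, |f j| ≤ c) : |∑ j, H j * f j| ≤ K * c :=
  calc _ ≤ ∑ j, |H j * f j| := Finset.abs_sum_le_sum_abs _ _
    _ ≤ ∑ j, |H j| * c := Finset.sum_le_sum fun j _ => by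
        rw [abs_mul]
        gcongr
        exact hf j
    _ ≤ _ := by
        rw [← Finset.sum_mul]
        gcongr

namespace IsGradientOracle

variable (h : IsGradientOracle q Δ g B F m)
include h

theorem norm_le (i : Fin M) (θ : E) : ‖g i θ‖ ≤ √(B * (Δ θ + F)) :=
  Real.le_sqrt_of_sq_le (h.norm_sq_le i θ)

theorem mean_norm_le (θ : E) : ‖meanField q g θ‖ ≤ √(B * Δ θ) :=
  Real.le_sqrt_of_sq_le (h.mean_norm_sq_le θ)

theorem mean_norm_le' (θ : E) : ‖meanField q g θ‖ ≤ √(B * (Δ θ + F)) :=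
  (h.mean_norm_le θ).trans (Real.sqrt_le_sqrt
    (mul_le_mul_of_nonneg_left (by linarith [h.F_nonneg]) (by linarith [h.one_le])))

theorem norm_sub_mean_le (i : Fin M) (θ : E) :
    ‖g i θ - meanField q g θ‖ ≤ 2 * √(B * (Δ θ + F)) :=
  (norm_sub_le _ _).trans (by linarith [h.norm_le i θ, h.mean_norm_le' θ])

theorem mean_lipschitz (θ θ' : E) :
    ‖meanField q g θ - meanField q g θ'‖ ≤ B * ‖θ - θ'‖ := by
  rw [meanField, meanField, ← Finset.sum_sub_distrib]
  calc _ ≤ ∑ i, ‖q i • g i θ - q i • g i θ'‖ := norm_sum_le _ _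
    _ ≤ ∑ i, q i * (B * ‖θ - θ'‖) := Finset.sum_le_sum fun i _ => by
        rw [← smul_sub, norm_smul, Real.norm_of_nonneg (h.mem_simplex.1 i)]
        exact mul_le_mul_of_nonneg_left (h.lipschitz i θ θ') (h.mem_simplex.1 i)
    _ = _ := by rw [← Finset.sum_mul, h.mem_simplex.2, one_mul]

theorem abs_gradientBias_le (i : Fin M) (θ : E) :
    |gradientBias q g i θ| ≤ 2 * B * √(Δ θ * (Δ θ + F)) := by
  have hB : 0 ≤ B := by linarith [h.one_le]
  calc _ ≤ ‖meanField q g θ‖ * ‖g i θ - meanField q g θ‖ := abs_real_inner_le_norm _ _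
    _ ≤ √(B * Δ θ) * (2 * √(B * (Δ θ + F))) := by
        gcongr
        exacts [h.mean_norm_le θ, h.norm_sub_mean_le i θ]
    _ = _ := by
        rw [Real.sqrt_mul hB, Real.sqrt_mul hB, Real.sqrt_mul (h.gap_nonneg θ)]
        linear_combination 2 * √(Δ θ) * √(Δ θ + F) * Real.mul_self_sqrt hB

theorem sqrt_gap_mul_le (θ : E) : √(Δ θ * (Δ θ + F)) ≤ Δ θ + F := by
  have h1 := h.gap_nonneg θ
  have h2 := h.F_nonneg
  exact Real.sqrt_le_iff.2 ⟨by linarith, by nlinarith⟩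

/-- Along a gradient step the bias changes by a second-order quantity. -/
theorem abs_gradientBias_sub_le {α : ℝ} (hα : 0 ≤ α) (hα1 : B * α ≤ 1) (i j : Fin M) (θ : E) :
    |gradientBias q g j θ - gradientBias q g j (θ - α • g i θ)| ≤
      6 * B ^ 2 * α * (Δ θ + F) := by
  have hB : 0 ≤ B := by linarith [h.one_le]
  set θ' := θ - α • g i θ with hθ'
  set r := √(B * (Δ θ + F)) with hr
  have hr0 : 0 ≤ r := Real.sqrt_nonneg _
  have hr2 : r ^ 2 = B * (Δ θ + F) := Real.sq_sqrt (mul_nonneg hB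
    (by linarith [h.gap_nonneg θ, h.F_nonneg]))
  have hd : ‖θ - θ'‖ ≤ α * r := by
    rw [hθ', sub_sub_cancel, norm_smul, Real.norm_of_nonneg hα]
    gcongr
    exact h.norm_le i θ
  have hBd : B * ‖θ - θ'‖ ≤ B * α * r := by
    rw [mul_assoc]
    gcongr
  have h1 : ‖meanField q g θ'‖ ≤ 2 * r := by
    have h2 := h.mean_norm_le' θ
    have h3 := (h.mean_lipschitz θ θ').trans hBd
    have h4 := norm_sub_norm_le (meanField q g θ') (meanField q g θ)
    rw [norm_sub_rev] at h4
    nlinarith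
  have h2 : ‖(g j θ - g j θ') - (meanField q g θ - meanField q g θ')‖ ≤ 2 * (B * α * r) :=
    (norm_sub_le _ _).trans (by linarith [(h.lipschitz j θ θ').trans hBd,
      (h.mean_lipschitz θ θ').trans hBd])
  have heq : gradientBias q g j θ - gradientBias q g j θ' =
      inner ℝ (meanField q g θ - meanField q g θ') (g j θ - meanField q g θ) +
      inner ℝ (meanField q g θ') ((g j θ - g j θ') - (meanField q g θ - meanField q g θ')) := by
    simp only [gradientBias, inner_sub_left, inner_sub_right]
    ring
  rw [heq]
  calc _ ≤ _ := abs_add_le _ _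
    _ ≤ ‖meanField q g θ - meanField q g θ'‖ * ‖g j θ - meanField q g θ‖ + ‖meanField q g θ'‖ *
        ‖(g j θ - g j θ') - (meanField q g θ - meanField q g θ')‖ :=
        add_le_add (abs_real_inner_le_norm _ _) (abs_real_inner_le_norm _ _)
    _ ≤ B * α * r * (2 * r) + 2 * r * (2 * (B * α * r)) := by
        gcongr
        exacts [(h.mean_lipschitz θ θ').trans hBd, h.norm_sub_mean_le j θ]
    _ = 6 * B * α * r ^ 2 := by ring
    _ = _ := by rw [hr2]; ring

variable {H : Fin M → Fin M → ℝ} {T : ℕ} (hH : ∀ i, ∑ j, |H i j| ≤ 4 * T)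
include hH

theorem abs_poissonCorrector_le (i : Fin M) (θ : E) :
    |poissonCorrector q g H i θ| ≤ 8 * B * T * √(Δ θ * (Δ θ + F)) := by
  have hB : 0 ≤ B := by linarith [h.one_le]
  exact (abs_sum_mul_le (hH i) (by positivity) fun j => h.abs_gradientBias_le j θ).trans_eq
    (by ring)

theorem abs_poissonCorrector_le' (i : Fin M) (θ : E) :
    |poissonCorrector q g H i θ| ≤ 8 * B * T * (Δ θ + F) := by
  have hB : 0 ≤ B := by linarith [h.one_le]
  refine (h.abs_poissonCorrector_le hH i θ).trans ?_
  gcongr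
  exact h.sqrt_gap_mul_le θ

theorem abs_poissonCorrector_sub_le {α : ℝ} (hα : 0 ≤ α) (hα1 : B * α ≤ 1) (i j : Fin M) (θ : E) :
    |poissonCorrector q g H j θ - poissonCorrector q g H j (θ - α • g i θ)| ≤
      24 * B ^ 2 * T * α * (Δ θ + F) := by
  have hX : 0 ≤ Δ θ + F := by linarith [h.gap_nonneg θ, h.F_nonneg]
  rw [poissonCorrector, poissonCorrector, ← Finset.sum_sub_distrib]
  simp only [← mul_sub]
  exact (abs_sum_mul_le (hH j) (by positivity)
    fun l => h.abs_gradientBias_sub_le hα hα1 i l θ).trans_eq (by ring)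

theorem abs_fluctuation_le {P : Matrix (Fin M) (Fin M) ℝ}
    (hP : P ∈ Matrix.rowStochastic ℝ (Fin M)) (i j : Fin M) (θ : E) :
    |fluctuation P q g H i j θ| ≤ 16 * B * T * √(Δ θ * (Δ θ + F)) := by
  have hB : 0 ≤ B := by linarith [h.one_le]
  have h1 : |∑ l, P i l * poissonCorrector q g H l θ| ≤
      1 * (8 * B * T * √(Δ θ * (Δ θ + F))) := by
    refine abs_sum_mul_le (H := P i) ?_ (by positivity) fun l => h.abs_poissonCorrector_le hH l θ
    rw [← Matrix.sum_row_of_mem_rowStochastic hP i]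
    exact Finset.sum_le_sum fun l _ =>
      (abs_of_nonneg (Matrix.nonneg_of_mem_rowStochastic hP)).le
  rw [fluctuation]
  refine (abs_sub _ _).trans ?_
  linarith [h.abs_poissonCorrector_le hH j θ]

theorem gap_le_lyapunov {α : ℝ} (hα : 0 ≤ α) (hα1 : 16 * B * T * α ≤ 1) (i : Fin M) (θ : E) :
    Δ θ ≤ 2 * lyapunov q Δ g H (8 * B * T * F) α i θ := by
  have h1 := (abs_le.1 (h.abs_poissonCorrector_le' hH i θ)).2
  have h2 := mul_le_mul_of_nonneg_left h1 hα
  have h3 := mul_le_mul_of_nonneg_right hα1 (h.gap_nonneg θ)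
  rw [lyapunov]
  nlinarith

theorem lyapunov_le {α : ℝ} (hα : 0 ≤ α) (hα1 : 16 * B * T * α ≤ 1) (i : Fin M) (θ : E) :
    lyapunov q Δ g H (8 * B * T * F) α i θ ≤ 3 / 2 * Δ θ + 16 * B * T * F * α := by
  have h1 := (abs_le.1 (h.abs_poissonCorrector_le' hH i θ)).1
  have h2 := mul_le_mul_of_nonneg_left h1 hα
  have h3 := mul_le_mul_of_nonneg_right hα1 (h.gap_nonneg θ)
  rw [lyapunov]
  nlinarith

/-- Up to the fluctuation of the corrector and terms of second order in the step size, a step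
along a local gradient contracts the Lyapunov function. -/
theorem lyapunov_step_le {P : Matrix (Fin M) (Fin M) ℝ} (hT : 1 ≤ T)
    (hHP : ∀ i j, H i j - ∑ l, P i l * H l j = (if i = j then 1 else 0) - q j)
    {α α' : ℝ} (hα' : 0 ≤ α') (hαα' : α' ≤ α) (hdiff : α - α' ≤ m * α ^ 2)
    (hα1 : B * α ≤ 1) (i j : Fin M) (θ : E) :
    lyapunov q Δ g H (8 * B * T * F) α' j (θ - α • g i θ) ≤
      (1 - 2 * m * α) * lyapunov q Δ g H (8 * B * T * F) α i θ +
        65 * B ^ 2 * T * α ^ 2 * (Δ θ + F) + α * fluctuation P q g H i j θ := by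
  have hα : 0 ≤ α := hα'.trans hαα'
  have hB1 := h.one_le
  have hB : 0 ≤ B := by linarith
  have hm := h.m_pos
  have hmB := h.m_le
  have hX : 0 ≤ Δ θ + F := by linarith [h.gap_nonneg θ, h.F_nonneg]
  have hF := h.F_nonneg
  have hT' : (1 : ℝ) ≤ T := by exact_mod_cast hT
  -- the descent inequality, with the bias expressed through the corrector
  have hdesc : Δ (θ - α • g i θ) ≤ Δ θ - 2 * m * α * Δ θ - α * gradientBias q g i θ +
      B ^ 2 * α ^ 2 * (Δ θ + F) := by
    have h1 := h.descent θ (-(α • g i θ))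
    rw [← sub_eq_add_neg, inner_neg_right, inner_smul_right, norm_neg, norm_smul, mul_pow,
      Real.norm_eq_abs, sq_abs] at h1
    have h2 : inner ℝ (meanField q g θ) (g i θ) =
        gradientBias q g i θ + ‖meanField q g θ‖ ^ 2 := by
      rw [gradientBias, inner_sub_right, real_inner_self_eq_norm_sq]
      ring
    rw [h2] at h1
    have h3 := mul_le_mul_of_nonneg_left (h.pl θ) hα
    have h4 := mul_le_mul_of_nonneg_left (h.norm_sq_le i θ) (show 0 ≤ B * α ^ 2 by positivity)
    linarith
  have hpoisson := gradientBias_eq (g := g) h.mem_simplex hHP i θ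
  have hcj := abs_le.1 (h.abs_poissonCorrector_le' hH j θ)
  have hci := abs_le.1 (h.abs_poissonCorrector_le' hH i θ)
  have hsub := abs_le.1 (h.abs_poissonCorrector_sub_le hH hα hα1 i j θ)
  rw [lyapunov, lyapunov, fluctuation]
  set X := Δ θ + F with hXdef
  set hj := poissonCorrector q g H j θ
  set hi := poissonCorrector q g H i θ
  set hj' := poissonCorrector q g H j (θ - α • g i θ)
  have e1 : (α - α') * hj ≤ 8 * (B ^ 2 * T * α ^ 2 * X) := by
    calc (α - α') * hj ≤ (α - α') * (8 * B * T * X) :=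
          mul_le_mul_of_nonneg_left hcj.2 (by linarith)
      _ ≤ (m * α ^ 2) * (8 * B * T * X) := mul_le_mul_of_nonneg_right hdiff (by positivity)
      _ ≤ (B * α ^ 2) * (8 * B * T * X) := by gcongr
      _ = _ := by ring
  have e2 : α' * (hj - hj') ≤ 24 * (B ^ 2 * T * α ^ 2 * X) := by
    calc α' * (hj - hj') ≤ α' * (24 * B ^ 2 * T * α * X) :=
          mul_le_mul_of_nonneg_left hsub.2 hα'
      _ ≤ α * (24 * B ^ 2 * T * α * X) := by gcongr
      _ = _ := by ring
  have e3 : -(2 * m * α ^ 2 * hi) ≤ 16 * (B ^ 2 * T * α ^ 2 * X) := by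
    calc -(2 * m * α ^ 2 * hi) = 2 * m * α ^ 2 * (-hi) := by ring
      _ ≤ 2 * m * α ^ 2 * (8 * B * T * X) :=
          mul_le_mul_of_nonneg_left (by linarith [hci.1]) (by positivity)
      _ ≤ 2 * B * α ^ 2 * (8 * B * T * X) := by gcongr
      _ = _ := by ring
  have e4 : 2 * m * α ^ 2 * (8 * B * T * F) ≤ 16 * (B ^ 2 * T * α ^ 2 * X) := by
    calc 2 * m * α ^ 2 * (8 * B * T * F) ≤ 2 * B * α ^ 2 * (8 * B * T * X) := by
          gcongr
          linarith [h.gap_nonneg θ]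
      _ = _ := by ring
  have e5 : B ^ 2 * α ^ 2 * X ≤ B ^ 2 * T * α ^ 2 * X := by
    have : 0 ≤ B ^ 2 * α ^ 2 * X := by positivity
    nlinarith
  have e6 : α' * (8 * B * T * F) ≤ α * (8 * B * T * F) := by gcongr
  have e7 : α * gradientBias q g i θ = α * hi - α * ∑ l, P i l * poissonCorrector q g H l θ := by
    rw [← hpoisson]
    ring
  rw [e7] at hdesc
  linarith

end IsGradientOracle

end Drift

/-! ### Functionals of a finite Markov chain; Hoeffding's lemma -/

section MarkovChain

variable {M : ℕ} {Ω : Type*} [MeasurableSpace Ω] {μ : Measure Ω} [IsProbabilityMeasure μ]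
  {P : Matrix (Fin M) (Fin M) ℝ} {Z : ℕ → Ω → Fin M}

/-- The path that follows `v` and then stays where it is. -/
def extendPath {k : ℕ} (v : Fin (k + 1) → Fin M) (i : ℕ) : Fin M :=
  v ⟨min i k, by omega⟩

theorem extendPath_of_le {k : ℕ} (v : Fin (k + 1) → Fin M) {i : ℕ} (hi : i ≤ k) :
    extendPath v i = v ⟨i, by omega⟩ := by
  simp only [extendPath, min_eq_left hi]

theorem apply_extendPath {β : Type*} {k : ℕ} {f : (ℕ → Fin M) → β}
    (hf : DependsOn f (Set.Iic k)) (z : ℕ → Fin M) :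
    f z = f (extendPath fun i : Fin (k + 1) => z i) :=
  hf fun i hi => by rw [extendPath_of_le _ hi]

theorem measurable_apply_path {β : Type*} [MeasurableSpace β] (hZ : ∀ k, Measurable (Z k)) {k : ℕ}
    {f : (ℕ → Fin M) → β} (hf : DependsOn f (Set.Iic k)) :
    Measurable fun ω => f fun j => Z j ω := by
  have h : (fun ω => f fun j => Z j ω) =
      (fun v : Fin (k + 1) → Fin M => f (extendPath v)) ∘ fun ω (i : Fin (k + 1)) => Z i ω :=
    funext fun ω => apply_extendPath hf _
  rw [h]
  exact (Measurable.of_discrete).comp (measurable_pi_lambda _ fun i => hZ i)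

theorem integrable_apply_path (hZ : ∀ k, Measurable (Z k)) {k : ℕ}
    {f : (ℕ → Fin M) → ℝ} (hf : DependsOn f (Set.Iic k)) :
    Integrable (fun ω => f fun j => Z j ω) μ := by
  refine Integrable.of_bound (measurable_apply_path hZ hf).aestronglyMeasurable
    (∑ v : Fin (k + 1) → Fin M, |f (extendPath v)|) (Filter.Eventually.of_forall fun ω => ?_)
  rw [apply_extendPath hf]
  exact Finset.single_le_sum (f := fun v : Fin (k + 1) → Fin M => |f (extendPath v)|)
    (fun _ _ => abs_nonneg _) (Finset.mem_univ _)

theorem integral_apply_path (hZ : ∀ k, Measurable (Z k)) {k : ℕ}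
    {f : (ℕ → Fin M) → ℝ} (hf : DependsOn f (Set.Iic k)) :
    ∫ ω, f (fun j => Z j ω) ∂μ = ∑ v : Fin (k + 1) → Fin M,
      μ.real {ω | ∀ i ≤ k, Z i ω = extendPath v i} * f (extendPath v) := by
  have hm : Measurable fun ω (i : Fin (k + 1)) => Z i ω := measurable_pi_lambda _ fun i => hZ i
  have : IsProbabilityMeasure (μ.map fun ω (i : Fin (k + 1)) => Z i ω) :=
    Measure.isProbabilityMeasure_map hm.aemeasurable
  calc _ = ∫ ω, f (extendPath fun i : Fin (k + 1) => Z i ω) ∂μ := by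
        exact integral_congr_ae (Filter.Eventually.of_forall fun ω => apply_extendPath hf _)
    _ = ∫ v, f (extendPath v) ∂(μ.map fun ω (i : Fin (k + 1)) => Z i ω) :=
        (integral_map hm.aemeasurable (f := fun v : Fin (k + 1) → Fin M => f (extendPath v))
          (Measurable.of_discrete).aestronglyMeasurable).symm
    _ = _ := by
        rw [integral_fintype Integrable.of_finite]
        refine Finset.sum_congr rfl fun v _ => ?_
        rw [map_measureReal_apply hm (measurableSet_singleton v), smul_eq_mul]
        congr 2
        ext ω
        simp only [Set.mem_preimage, Set.mem_singleton_iff, Set.mem_ofPred_eq, funext_iff]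
        constructor
        · intro h i hi
          rw [extendPath_of_le _ hi, ← h]
        · intro h i
          rw [h i (by omega), extendPath_of_le _ (by omega)]

/-- The Markov property for functionals of the path: averaging over the last step. -/
theorem integral_apply_path_le (hZ : IsMarkovChain μ P Z) {k : ℕ}
    {Ψ Φ : (ℕ → Fin M) → ℝ} (hΨ : DependsOn Ψ (Set.Iic (k + 1))) (hΦ : DependsOn Φ (Set.Iic k))
    (h : ∀ z, ∑ j, P (z k) j * Ψ (Function.update z (k + 1) j) ≤ Φ z) :
    ∫ ω, Ψ (fun j => Z j ω) ∂μ ≤ ∫ ω, Φ (fun j => Z j ω) ∂μ := by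
  rw [integral_apply_path hZ.1 hΨ, integral_apply_path hZ.1 hΦ,
    ← (Fin.snocEquiv fun _ : Fin (k + 2) => Fin M).sum_comp, Fintype.sum_prod_type_right]
  refine Finset.sum_le_sum fun v _ => ?_
  have hsnoc : ∀ j, ∀ i ≤ k + 1,
      extendPath ((Fin.snocEquiv fun _ : Fin (k + 2) => Fin M) (j, v)) i =
        Function.update (extendPath v) (k + 1) j i := fun j i hi => by
    rw [extendPath_of_le _ hi]
    rcases hi.eq_or_lt with rfl | hlt
    · rw [Function.update_self]
      exact Fin.snoc_last (α := fun _ => Fin M) j v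
    · rw [Function.update_of_ne hlt.ne, extendPath_of_le _ (by omega)]
      exact Fin.snoc_castSucc (α := fun _ => Fin M) j v ⟨i, by omega⟩
  refine le_trans (le_of_eq ?_) (mul_le_mul_of_nonneg_left (h (extendPath v)) measureReal_nonneg)
  rw [Finset.mul_sum]
  refine Finset.sum_congr rfl fun j _ => ?_
  rw [hΨ (hsnoc j), hZ.2, ← mul_assoc]
  congr 2
  · congr 1
    ext ω
    refine forall₂_congr fun i hi => ?_
    rw [hsnoc j i (by omega), Function.update_of_ne (by omega)]
  · rw [hsnoc j k (by omega), hsnoc j _ le_rfl, Function.update_of_ne (by omega),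
      Function.update_self]

end MarkovChain

section Moments

variable {ι : Type*} [Fintype ι] {p : ι → ℝ} {x : ι → ℝ}

/-- Hoeffding's lemma for a finite distribution of mean zero. -/
theorem sum_mul_exp_le (hp : p ∈ stdSimplex ℝ ι) (hx : ∑ i, p i * x i = 0) {c : ℝ}
    (hc : ∀ i, |x i| ≤ c) : ∑ i, p i * Real.exp (x i) ≤ Real.exp (c ^ 2 / 2) := by
  by_cases hc0 : c ≤ 0
  · have hx0 : ∀ i, x i = 0 := fun i => abs_nonpos_iff.1 ((hc i).trans hc0)
    simp only [hx0, Real.exp_zero, mul_one, hp.2]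
    exact Real.one_le_exp (by positivity)
  push Not at hc0
  -- convexity of `exp` on `[-c, c]`
  have hconv : ∀ i, Real.exp (x i) ≤ Real.cosh c + x i / c * Real.sinh c := fun i => by
    have hi := abs_le.1 (hc i)
    have h1 : 0 ≤ (1 - x i / c) / 2 := by
      have : x i / c ≤ 1 := (div_le_one hc0).2 hi.2
      linarith
    have h2 : 0 ≤ (1 + x i / c) / 2 := by
      have : -1 ≤ x i / c := by
        rw [le_div_iff₀ hc0]
        linarith
      linarith
    have h3 := convexOn_exp.2 (Set.mem_univ (-c)) (Set.mem_univ c) h1 h2 (by ring)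
    simp only [smul_eq_mul] at h3
    have h4 : (1 - x i / c) / 2 * -c + (1 + x i / c) / 2 * c = x i := by
      field_simp
      ring
    rw [h4] at h3
    rw [Real.cosh_eq, Real.sinh_eq]
    linarith
  calc _ ≤ ∑ i, p i * (Real.cosh c + x i / c * Real.sinh c) :=
        Finset.sum_le_sum fun i _ => mul_le_mul_of_nonneg_left (hconv i) (hp.1 i)
    _ = (∑ i, p i) * Real.cosh c + (∑ i, p i * x i) * (Real.sinh c / c) := by
        rw [Finset.sum_mul, Finset.sum_mul, ← Finset.sum_add_distrib]
        exact Finset.sum_congr rfl fun i _ => by ring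
    _ = Real.cosh c := by rw [hp.2, hx, one_mul, zero_mul, add_zero]
    _ ≤ _ := Real.cosh_le_exp_half_sq c

end Moments

/-! ### The Lyapunov function along the token iteration; the bound in expectation -/

section TokenPath

variable {M : ℕ} {E : Type*} [NormedAddCommGroup E] [InnerProductSpace ℝ E]

/-- The token iteration with general local fields `g i` in place of the local gradients. -/
def tokenPath (g : Fin M → E → E) (α : ℕ → ℝ) (θ₀ : E) (z : ℕ → Fin M) : ℕ → E
  | 0 => θ₀
  | k + 1 => tokenPath g α θ₀ z k - α k • g (z k) (tokenPath g α θ₀ z k)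

theorem iterate_eq_tokenPath {d : ℕ} {n : Fin M → ℕ} (A : ∀ i, Matrix (Fin (n i)) (Fin d) ℝ)
    (b : ∀ i, EuclideanSpace ℝ (Fin (n i))) (α : ℕ → ℝ) (θ₀ : EuclideanSpace ℝ (Fin d))
    (z : ℕ → Fin M) (k : ℕ) :
    iterate A b α θ₀ z k = tokenPath (fun i => gradient (localLoss A b i)) α θ₀ z k := by
  induction k with
  | zero => rfl
  | succ k ih => rw [iterate, tokenPath, ih]

theorem tokenPath_congr (g : Fin M → E → E) (α : ℕ → ℝ) (θ₀ : E) {z z' : ℕ → Fin M} {k : ℕ}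
    (h : ∀ i < k, z i = z' i) : tokenPath g α θ₀ z k = tokenPath g α θ₀ z' k := by
  induction k with
  | zero => rfl
  | succ k ih => rw [tokenPath, tokenPath, ih fun i hi => h i (by omega), h k (by omega)]

theorem tokenPath_update (g : Fin M → E → E) (α : ℕ → ℝ) (θ₀ : E) (z : ℕ → Fin M) {i k : ℕ}
    (hi : i ≤ k) (j : Fin M) :
    tokenPath g α θ₀ (Function.update z k j) i = tokenPath g α θ₀ z i :=
  tokenPath_congr g α θ₀ fun l hl => Function.update_of_ne (by omega) _ _

/-- The Lyapunov function along the token iteration. -/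
def pathLyapunov (q : Fin M → ℝ) (Δ : E → ℝ) (g : Fin M → E → E) (H : Fin M → Fin M → ℝ) (c : ℝ)
    (α : ℕ → ℝ) (θ₀ : E) (k : ℕ) (z : ℕ → Fin M) : ℝ :=
  lyapunov q Δ g H c (α k) (z k) (tokenPath g α θ₀ z k)

theorem dependsOn_pathLyapunov (q : Fin M → ℝ) (Δ : E → ℝ) (g : Fin M → E → E)
    (H : Fin M → Fin M → ℝ) (c : ℝ) (α : ℕ → ℝ) (θ₀ : E) (k : ℕ) :
    DependsOn (pathLyapunov q Δ g H c α θ₀ k) (Set.Iic k) := fun z z' h => by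
  rw [pathLyapunov, pathLyapunov, h k (Set.mem_Iic.2 le_rfl),
    tokenPath_congr g α θ₀ fun i hi => h i (le_of_lt hi)]

theorem dependsOn_gap_tokenPath (Δ : E → ℝ) (g : Fin M → E → E) (α : ℕ → ℝ) (θ₀ : E) (k : ℕ) :
    DependsOn (fun z => Δ (tokenPath g α θ₀ z k)) (Set.Iic k) := fun z z' h => by
  simp only [tokenPath_congr g α θ₀ fun i hi => h i (le_of_lt hi)]

end TokenPath

section Bounds

variable {M : ℕ} {E : Type*} [NormedAddCommGroup E] [InnerProductSpace ℝ E]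
  {q : Fin M → ℝ} {Δ : E → ℝ} {g : Fin M → E → E} {B F m : ℝ}
  {H : Fin M → Fin M → ℝ} {T : ℕ} {P : Matrix (Fin M) (Fin M) ℝ} {a K₀ : ℝ}

namespace IsGradientOracle

variable (h : IsGradientOracle q Δ g B F m)
include h

theorem stepConst_pos (ha : 2 ≤ m * a) : 0 < a := by
  have := h.m_pos
  by_contra! hn
  nlinarith

/-- The lower bound on the offset `K₀` forces it to be large, since `m ≤ B`. -/
theorem le_offset (hT : 1 ≤ T) (ha : 2 ≤ m * a) (hK : 260 * B ^ 2 * T * a ≤ m * K₀) :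
    520 ≤ K₀ := by
  have hm := h.m_pos
  have hB := h.one_le
  have ha0 := h.stepConst_pos ha
  have hT' : (1 : ℝ) ≤ T := by exact_mod_cast hT
  have h1 : 260 * B ^ 2 * a ≤ m * K₀ :=
    (by nlinarith [show 0 ≤ 260 * B ^ 2 * a by positivity] : 260 * B ^ 2 * a ≤ _).trans hK
  have h2 : m ^ 2 ≤ B ^ 2 := pow_le_pow_left₀ hm.le h.m_le 2
  have h3 : 260 * m ^ 2 * a ≤ m * K₀ := le_trans (by gcongr) h1
  have h4 : m * (260 * (m * a)) ≤ m * K₀ := by linarith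
  linarith [le_of_mul_le_mul_left h4 hm]

theorem step_div_bounds (hT : 1 ≤ T) (ha : 2 ≤ m * a) (hK : 260 * B ^ 2 * T * a ≤ m * K₀) {s : ℝ}
    (hs : K₀ ≤ s) : 0 < s ∧ 0 ≤ a / s ∧ 260 * B ^ 2 * T * (a / s) ≤ m ∧
      16 * B * T * (a / s) ≤ 1 ∧ B * (a / s) ≤ 1 := by
  have hm := h.m_pos
  have hB := h.one_le
  have ha0 := h.stepConst_pos ha
  have hT' : (1 : ℝ) ≤ T := by exact_mod_cast hT
  have hs0 : 0 < s := by linarith [h.le_offset hT ha hK]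
  have hα : 0 ≤ a / s := by positivity
  have h1 : 260 * B ^ 2 * T * (a / s) ≤ m := by
    rw [← mul_div_assoc, div_le_iff₀ hs0]
    exact hK.trans (by gcongr)
  have h2 : B * (260 * (B * T * (a / s))) ≤ B * 1 := by linarith [h.m_le]
  have h3 := le_of_mul_le_mul_left h2 (by linarith)
  have h4 : 0 ≤ B * (a / s) := by positivity
  refine ⟨hs0, hα, h1, by nlinarith, by nlinarith⟩

/-- One step of the Lyapunov recursion for step sizes `a / (k + K₀)`; here `s = k + K₀`. The
offset `K₀` is large enough for the second-order terms to be absorbed by the contraction. -/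
theorem lyapunov_step_div_le (hH : ∀ i, ∑ j, |H i j| ≤ 4 * T) (hT : 1 ≤ T)
    (hHP : ∀ i j, H i j - ∑ l, P i l * H l j = (if i = j then 1 else 0) - q j)
    (ha : 2 ≤ m * a) (hK : 260 * B ^ 2 * T * a ≤ m * K₀) {s : ℝ} (hs : K₀ ≤ s)
    (i j : Fin M) (θ : E) :
    lyapunov q Δ g H (8 * B * T * F) (a / (s + 1)) j (θ - (a / s) • g i θ) ≤
      (1 - 3 / s) * lyapunov q Δ g H (8 * B * T * F) (a / s) i θ +
        65 * B ^ 2 * T * F * a ^ 2 / s ^ 2 + a / s * fluctuation P q g H i j θ := by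
  obtain ⟨hs0, hα, hα1, hα2, hα3⟩ := h.step_div_bounds hT ha hK hs
  have ha0 := h.stepConst_pos ha
  have hm := h.m_pos
  have hB := h.one_le
  have hdiff : a / s - a / (s + 1) ≤ m * (a / s) ^ 2 := by
    have h1 : a / s - a / (s + 1) = a / (s * (s + 1)) := by
      field_simp
      ring
    calc a / s - a / (s + 1) = a / (s * (s + 1)) := h1
      _ ≤ a / (s * s) := by gcongr; linarith
      _ ≤ m * a * a / (s * s) := by
          gcongr
          nlinarith
      _ = _ := by
          field_simp
  have hstep := h.lyapunov_step_le hH hT hHP (by positivity)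
    (div_le_div_of_nonneg_left ha0.le hs0 (by linarith)) hdiff hα3 i j θ
  have hΔ := h.gap_le_lyapunov hH hα hα2 i θ
  have hΔ0 := h.gap_nonneg θ
  set W := lyapunov q Δ g H (8 * B * T * F) (a / s) i θ
  have hW : 0 ≤ W := by linarith
  -- the second-order term in the gap costs a quarter of the contraction
  have h1 : 65 * B ^ 2 * T * (a / s) ^ 2 * Δ θ ≤ m / 2 * (a / s) * W := by
    calc 65 * B ^ 2 * T * (a / s) ^ 2 * Δ θ ≤ 65 * B ^ 2 * T * (a / s) ^ 2 * (2 * W) := by gcongr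
      _ = 260 * B ^ 2 * T * (a / s) * ((a / s) * W / 2) := by ring
      _ ≤ m * ((a / s) * W / 2) := by gcongr
      _ = _ := by ring
  have h2 : 2 / s ≤ m * (a / s) := by
    rw [← mul_div_assoc]
    gcongr
  have h3 : 65 * B ^ 2 * T * F * a ^ 2 / s ^ 2 = 65 * B ^ 2 * T * (a / s) ^ 2 * F := by ring
  have h4 : 3 / s * W ≤ 3 / 2 * (m * (a / s)) * W := by
    refine mul_le_mul_of_nonneg_right ?_ hW
    calc 3 / s = 3 / 2 * (2 / s) := by ring
      _ ≤ _ := by gcongr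
  rw [h3]
  linarith

/-- The initial value of the recursion: `K₀` cancels the step size `a / K₀` of the corrector. -/
theorem offset_mul_pathLyapunov_zero_le (hH : ∀ i, ∑ j, |H i j| ≤ 4 * T) (hT : 1 ≤ T)
    (ha : 2 ≤ m * a) (hK : 260 * B ^ 2 * T * a ≤ m * K₀) (θ₀ : E) (z : ℕ → Fin M) :
    K₀ * pathLyapunov q Δ g H (8 * B * T * F) (fun j => a / (j + K₀)) θ₀ 0 z ≤
      3 / 2 * (K₀ * Δ θ₀) + 16 * B * T * F * a := by
  obtain ⟨hs0, hα, -, hα2, -⟩ := h.step_div_bounds hT ha hK le_rfl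
  have h1 := h.lyapunov_le hH hα hα2 (z 0) θ₀
  have h2 := mul_le_mul_of_nonneg_left h1 hs0.le
  have h3 : K₀ * (3 / 2 * Δ θ₀ + 16 * B * T * F * (a / K₀)) =
      3 / 2 * (K₀ * Δ θ₀) + 16 * B * T * F * a := by
    field_simp
  rw [pathLyapunov, tokenPath, Nat.cast_zero, zero_add]
  exact h2.trans_eq h3

theorem gap_le_pathLyapunov (hH : ∀ i, ∑ j, |H i j| ≤ 4 * T) (hT : 1 ≤ T)
    (ha : 2 ≤ m * a) (hK : 260 * B ^ 2 * T * a ≤ m * K₀) (θ₀ : E) (k : ℕ) (z : ℕ → Fin M) :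
    Δ (tokenPath g (fun j => a / (j + K₀)) θ₀ z k) ≤
      2 * pathLyapunov q Δ g H (8 * B * T * F) (fun j => a / (j + K₀)) θ₀ k z := by
  obtain ⟨hs0, hα, -, hα2, -⟩ := h.step_div_bounds (s := k + K₀) hT ha hK (by simp)
  exact h.gap_le_lyapunov hH hα hα2 (z k) _

/-- The Lyapunov recursion along a path whose last step leads to `j`. -/
theorem pathLyapunov_update_le (hH : ∀ i, ∑ j, |H i j| ≤ 4 * T) (hT : 1 ≤ T)
    (hHP : ∀ i j, H i j - ∑ l, P i l * H l j = (if i = j then 1 else 0) - q j)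
    (ha : 2 ≤ m * a) (hK : 260 * B ^ 2 * T * a ≤ m * K₀) (θ₀ : E) (k : ℕ) (z : ℕ → Fin M)
    (j : Fin M) :
    pathLyapunov q Δ g H (8 * B * T * F) (fun j => a / (j + K₀)) θ₀ (k + 1)
        (Function.update z (k + 1) j) ≤
      (1 - 3 / (k + K₀)) * pathLyapunov q Δ g H (8 * B * T * F) (fun j => a / (j + K₀)) θ₀ k z +
        65 * B ^ 2 * T * F * a ^ 2 / (k + K₀) ^ 2 + a / (k + K₀) *
          fluctuation P q g H (z k) j (tokenPath g (fun j => a / (j + K₀)) θ₀ z k) := by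
  have h1 := h.lyapunov_step_div_le hH hT hHP ha hK (s := k + K₀) (by simp) (z k) j
    (tokenPath g (fun j => a / (j + K₀)) θ₀ z k)
  have hcast : ((k + 1 : ℕ) : ℝ) + K₀ = k + K₀ + 1 := by
    push_cast
    ring
  rw [pathLyapunov, tokenPath_update _ _ _ _ le_rfl, Function.update_self]
  simp only [hcast]
  exact h1

section Expectation

variable {Ω : Type*} [MeasurableSpace Ω] {μ : Measure Ω} [IsProbabilityMeasure μ]
  {Z : ℕ → Ω → Fin M}

theorem integral_pathLyapunov_le (hP : P ∈ Matrix.rowStochastic ℝ (Fin M))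
    (hH : ∀ i, ∑ j, |H i j| ≤ 4 * T) (hT : 1 ≤ T)
    (hHP : ∀ i j, H i j - ∑ l, P i l * H l j = (if i = j then 1 else 0) - q j)
    (ha : 2 ≤ m * a) (hK : 260 * B ^ 2 * T * a ≤ m * K₀) (hZ : IsMarkovChain μ P Z) (θ₀ : E)
    (k : ℕ) :
    ∫ ω, pathLyapunov q Δ g H (8 * B * T * F) (fun j => a / (j + K₀)) θ₀ k (fun j => Z j ω) ∂μ ≤
      (3 / 2 * (K₀ * Δ θ₀) + 16 * B * T * F * a + 65 * B ^ 2 * T * F * a ^ 2) / (k + K₀) := by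
  have hB : 0 ≤ B := by linarith [h.one_le]
  have hF := h.F_nonneg
  have hΔ0 := h.gap_nonneg θ₀
  have ha0 := h.stepConst_pos ha
  have hK0 := h.le_offset hT ha hK
  induction k with
  | zero =>
    rw [Nat.cast_zero, zero_add, le_div_iff₀ (by linarith), mul_comm, ← integral_const_mul]
    calc _ ≤ ∫ ω, (3 / 2 * (K₀ * Δ θ₀) + 16 * B * T * F * a) ∂μ :=
          integral_mono
            ((integrable_apply_path hZ.1 (dependsOn_pathLyapunov _ _ _ _ _ _ _ 0)).const_mul _)
            (integrable_const _)
            fun ω => h.offset_mul_pathLyapunov_zero_le hH hT ha hK θ₀ _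
      _ ≤ _ := by
          rw [integral_const, probReal_univ, one_smul]
          exact le_add_of_nonneg_right (by positivity)
  | succ k ih =>
    set s : ℝ := k + K₀ with hs
    have hs1 : 520 ≤ s := hK0.trans (by simp [hs])
    set G := 65 * B ^ 2 * T * F * a ^ 2 with hG
    have hG0 : 0 ≤ G := by positivity
    set X := 3 / 2 * (K₀ * Δ θ₀) + 16 * B * T * F * a + G with hX
    have hXG : G ≤ X := by
      rw [hX]
      exact le_add_of_nonneg_left (by positivity)
    set V := pathLyapunov q Δ g H (8 * B * T * F) (fun j => a / (j + K₀)) θ₀ with hV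
    have hdep := dependsOn_pathLyapunov q Δ g H (8 * B * T * F) (fun j => a / (j + K₀)) θ₀ k
    have hint : Integrable (fun ω => V k fun j => Z j ω) μ := integrable_apply_path hZ.1 hdep
    have hstep : ∫ ω, V (k + 1) (fun j => Z j ω) ∂μ ≤
        ∫ ω, ((1 - 3 / s) * V k (fun j => Z j ω) + G / s ^ 2) ∂μ := by
      refine integral_apply_path_le hZ (Φ := fun z => (1 - 3 / s) * V k z + G / s ^ 2)
        (dependsOn_pathLyapunov _ _ _ _ _ _ _ _) (fun z z' hz => by simp only [hV, hdep hz])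
        fun z => ?_
      calc _ ≤ ∑ j, P (z k) j * ((1 - 3 / s) * V k z + G / s ^ 2 + a / s *
              fluctuation P q g H (z k) j (tokenPath g (fun j => a / (j + K₀)) θ₀ z k)) :=
            Finset.sum_le_sum fun j _ => mul_le_mul_of_nonneg_left
              (h.pathLyapunov_update_le hH hT hHP ha hK θ₀ k z j)
              (Matrix.nonneg_of_mem_rowStochastic hP)
        _ = (∑ j, P (z k) j) * ((1 - 3 / s) * V k z + G / s ^ 2) + a / s * ∑ j, P (z k) j *
              fluctuation P q g H (z k) j (tokenPath g (fun j => a / (j + K₀)) θ₀ z k) := by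
            rw [Finset.sum_mul, Finset.mul_sum, ← Finset.sum_add_distrib]
            exact Finset.sum_congr rfl fun j _ => by ring
        _ = _ := by
            rw [sum_mul_fluctuation hP, Matrix.sum_row_of_mem_rowStochastic hP, one_mul, mul_zero,
              add_zero]
    rw [integral_add (hint.const_mul _) (integrable_const _), integral_const_mul, integral_const,
      probReal_univ, one_smul] at hstep
    -- `(1 - 3 / s) / s + 1 / s ^ 2 ≤ 1 / (s + 1)` carries the bound `X / s` to the next time
    have hc : 0 ≤ 1 - 3 / s := by
      rw [sub_nonneg, div_le_one (by linarith)]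
      linarith
    calc _ ≤ _ := hstep
      _ ≤ (1 - 3 / s) * (X / s) + X / s ^ 2 := by gcongr
      _ = X * ((s - 2) / s ^ 2) := by
          field_simp
          ring
      _ ≤ X * (1 / (s + 1)) := by
          refine mul_le_mul_of_nonneg_left ?_ (hG0.trans hXG)
          rw [div_le_div_iff₀ (by positivity) (by linarith)]
          nlinarith
      _ = _ := by
          rw [hs]
          push_cast
          ring

/-- The bound in expectation. -/
theorem integral_gap_le (hP : P ∈ Matrix.rowStochastic ℝ (Fin M)) (hT : IsMixingTime P q T)
    (ha : 2 ≤ m * a) (hK : 260 * B ^ 2 * T * a ≤ m * K₀) (hZ : IsMarkovChain μ P Z) (θ₀ : E)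
    (k : ℕ) :
    ∫ ω, Δ (tokenPath g (fun j => a / (j + K₀)) θ₀ (fun j => Z j ω) k) ∂μ ≤
      (3 * (K₀ * Δ θ₀) + 32 * B * T * F * a + 130 * B ^ 2 * T * F * a ^ 2) / (k + K₀) := by
  obtain ⟨H, hH, hHP⟩ := exists_poissonKernel hP hT
  calc _ ≤ ∫ ω, 2 * pathLyapunov q Δ g H (8 * B * T * F) (fun j => a / (j + K₀)) θ₀ k
          (fun j => Z j ω) ∂μ :=
        integral_mono (integrable_apply_path hZ.1 (dependsOn_gap_tokenPath Δ g _ θ₀ k))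
          ((integrable_apply_path hZ.1 (dependsOn_pathLyapunov _ _ _ _ _ _ _ k)).const_mul _)
          fun ω => h.gap_le_pathLyapunov hH hT.1 ha hK θ₀ k _
    _ ≤ 2 * ((3 / 2 * (K₀ * Δ θ₀) + 16 * B * T * F * a + 65 * B ^ 2 * T * F * a ^ 2) /
          (k + K₀)) := by
        rw [integral_const_mul]
        gcongr
        exact h.integral_pathLyapunov_le hP hH hT.1 hHP ha hK hZ θ₀ k
    _ = _ := by ring

end Expectation

end IsGradientOracle
end Bounds

/-! ### The bound with high probability -/

section HighProbability

theorem sum_range_one_div_le (k : ℕ) :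
    ∑ i ∈ Finset.range k, 1 / ((i : ℝ) + 1) ≤ 1 + Real.log k := by
  have h := harmonic_le_one_add_log k
  rw [harmonic] at h
  push_cast at h
  simpa only [one_div] using h


variable {M : ℕ} {E : Type*} [NormedAddCommGroup E] [InnerProductSpace ℝ E]
  {q : Fin M → ℝ} {Δ : E → ℝ} {g : Fin M → E → E} {B F m : ℝ}
  {H : Fin M → Fin M → ℝ} {T : ℕ} {P : Matrix (Fin M) (Fin M) ℝ} {a K₀ : ℝ}
  {Ω : Type*} [MeasurableSpace Ω] {μ : Measure Ω} [IsProbabilityMeasure μ]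
  {Z : ℕ → Ω → Fin M}

namespace IsGradientOracle

variable (h : IsGradientOracle q Δ g B F m)
include h

/-- While the gap is at most `D`, the fluctuation is sub-Gaussian with a variance proxy
proportional to the Lyapunov function itself. At the scale `η` this is absorbed by the contraction,
so `exp (η s W)` is almost a supermartingale. -/
theorem sum_mul_exp_pathLyapunov_le (hP : P ∈ Matrix.rowStochastic ℝ (Fin M))
    (hH : ∀ i, ∑ j, |H i j| ≤ 4 * T) (hT : 1 ≤ T)
    (hHP : ∀ i j, H i j - ∑ l, P i l * H l j = (if i = j then 1 else 0) - q j)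
    (ha : 2 ≤ m * a) (hK : 260 * B ^ 2 * T * a ≤ m * K₀) (θ₀ : E) (k : ℕ) (z : ℕ → Fin M)
    {D η : ℝ} (hη : 0 < η) (hη1 : η * (1024 * a ^ 2 * B ^ 2 * T ^ 2 * (D + F)) = 1)
    (hD : Δ (tokenPath g (fun j => a / (j + K₀)) θ₀ z k) ≤ D) :
    ∑ j, P (z k) j * Real.exp (η * (k + K₀ + 1) * pathLyapunov q Δ g H (8 * B * T * F)
        (fun j => a / (j + K₀)) θ₀ (k + 1) (Function.update z (k + 1) j)) ≤
      Real.exp (η * (k + K₀) * pathLyapunov q Δ g H (8 * B * T * F)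
        (fun j => a / (j + K₀)) θ₀ k z + 1 / (k + K₀)) := by
  have hB : 0 ≤ B := by linarith [h.one_le]
  have hF := h.F_nonneg
  have ha0 := h.stepConst_pos ha
  have hT' : (1 : ℝ) ≤ T := by exact_mod_cast hT
  have hstep := fun j => h.pathLyapunov_update_le hH hT hHP ha hK θ₀ k z j
  have hΔ0 := h.gap_nonneg (tokenPath g (fun j => a / (j + K₀)) θ₀ z k)
  have hΔW := h.gap_le_pathLyapunov hH hT ha hK θ₀ k z
  have hfl := fun j => h.abs_fluctuation_le hH hP (z k) j
    (tokenPath g (fun j => a / (j + K₀)) θ₀ z k)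
  have hs1 : 520 ≤ (k : ℝ) + K₀ := (h.le_offset hT ha hK).trans (by simp)
  set θ := tokenPath g (fun j => a / (j + K₀)) θ₀ z k
  set W := pathLyapunov q Δ g H (8 * B * T * F) (fun j => a / (j + K₀)) θ₀ k z
  set s : ℝ := k + K₀
  set G := 65 * B ^ 2 * T * F * a ^ 2 with hG
  have hW : 0 ≤ W := by linarith
  have hG0 : 0 ≤ G := by positivity
  have hX : 0 ≤ Δ θ * (Δ θ + F) := by positivity
  -- `c` bounds the exponents of the fluctuations
  set c := η * (2 * a) * (16 * B * T * √(Δ θ * (Δ θ + F))) with hc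
  have hss : (s + 1) * (a / s) ≤ 2 * a := by
    rw [← mul_div_assoc, div_le_iff₀ (by linarith)]
    nlinarith
  have hx : ∀ j, |η * ((s + 1) * (a / s)) * fluctuation P q g H (z k) j θ| ≤ c := fun j => by
    have h0 : 0 ≤ η * ((s + 1) * (a / s)) := by positivity
    rw [abs_mul, abs_of_nonneg h0, hc]
    gcongr
    exact hfl j
  have hmean : ∑ j, P (z k) j * (η * ((s + 1) * (a / s)) * fluctuation P q g H (z k) j θ) = 0 := by
    have h1 := sum_mul_fluctuation (q := q) (g := g) hP H (z k) θ
    rw [← mul_zero (η * ((s + 1) * (a / s))), ← h1, Finset.mul_sum]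
    exact Finset.sum_congr rfl fun j _ => by ring
  have hsimplex : P (z k) ∈ stdSimplex ℝ (Fin M) :=
    ⟨fun j => Matrix.nonneg_of_mem_rowStochastic hP, Matrix.sum_row_of_mem_rowStochastic hP _⟩
  have hsub := sum_mul_exp_le hsimplex hmean hx
  -- the choice of `η`: the Gaussian term is at most `η W`
  have hc2 : c ^ 2 / 2 ≤ η * W := by
    calc c ^ 2 / 2 = 512 * η ^ 2 * a ^ 2 * B ^ 2 * T ^ 2 * (Δ θ * (Δ θ + F)) := by
          rw [hc, mul_pow, mul_pow (16 * B * T : ℝ), Real.sq_sqrt hX]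
          ring
      _ ≤ 512 * η ^ 2 * a ^ 2 * B ^ 2 * T ^ 2 * (2 * W * (D + F)) := by gcongr
      _ = η * (η * (1024 * a ^ 2 * B ^ 2 * T ^ 2 * (D + F))) * W := by ring
      _ = η * W := by rw [hη1, mul_one]
  have hGη : η * (2 * G) ≤ 1 := by
    rw [← hη1, hG]
    have h1 : (T : ℝ) ≤ T ^ 2 := by nlinarith
    have h2 : F ≤ D + F := by linarith
    have h3 : 0 ≤ D + F := hF.trans h2
    calc η * (2 * (65 * B ^ 2 * T * F * a ^ 2)) = η * (130 * a ^ 2 * B ^ 2 * T * F) := by ring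
      _ ≤ η * (1024 * a ^ 2 * B ^ 2 * T ^ 2 * (D + F)) := by gcongr; norm_num
  set e := η * (s + 1) * ((1 - 3 / s) * W + G / s ^ 2) with he
  -- the contraction `(s + 1) (1 - 3 / s) ≤ s - 1` leaves room for this term
  have he1 : e + η * W ≤ η * s * W + 1 / s := by
    have h1 : (s + 1) * (1 - 3 / s) + 1 ≤ s := by
      have h2 : 0 < 3 / s := by positivity
      have h3 : (s + 1) * (1 - 3 / s) = s - 2 - 3 / s := by
        field_simp
        ring
      linarith
    have h2 : η * (s + 1) * (G / s ^ 2) ≤ 1 / s := by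
      calc η * (s + 1) * (G / s ^ 2) ≤ η * (2 * s) * (G / s ^ 2) := by gcongr; linarith
        _ = η * (2 * G) / s := by field_simp
        _ ≤ 1 / s := by gcongr
    have h3 := mul_le_mul_of_nonneg_left h1 (show 0 ≤ η * W by positivity)
    rw [he]
    linarith
  calc _ ≤ ∑ j, P (z k) j * (Real.exp e *
        Real.exp (η * ((s + 1) * (a / s)) * fluctuation P q g H (z k) j θ)) := by
        refine Finset.sum_le_sum fun j _ => mul_le_mul_of_nonneg_left ?_
          (Matrix.nonneg_of_mem_rowStochastic hP)
        rw [← Real.exp_add]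
        refine Real.exp_le_exp.2 ?_
        have h1 := mul_le_mul_of_nonneg_left (hstep j) (show 0 ≤ η * (s + 1) by positivity)
        rw [he]
        linarith
    _ = Real.exp e * ∑ j, P (z k) j *
        Real.exp (η * ((s + 1) * (a / s)) * fluctuation P q g H (z k) j θ) := by
        rw [Finset.mul_sum]
        exact Finset.sum_congr rfl fun j _ => by ring
    _ ≤ Real.exp e * Real.exp (η * W) := by
        gcongr
        exact hsub.trans (Real.exp_le_exp.2 hc2)
    _ = Real.exp (e + η * W) := (Real.exp_add _ _).symm
    _ ≤ _ := Real.exp_le_exp.2 he1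

open scoped Classical in
/-- Exponential moment of the Lyapunov function, on the event that all earlier gaps are at most
`D`. -/
theorem integral_exp_pathLyapunov_le (hP : P ∈ Matrix.rowStochastic ℝ (Fin M))
    (hH : ∀ i, ∑ j, |H i j| ≤ 4 * T) (hT : 1 ≤ T)
    (hHP : ∀ i j, H i j - ∑ l, P i l * H l j = (if i = j then 1 else 0) - q j)
    (ha : 2 ≤ m * a) (hK : 260 * B ^ 2 * T * a ≤ m * K₀) (hZ : IsMarkovChain μ P Z) (θ₀ : E)
    {D η : ℝ} (hη : 0 < η) (hη1 : η * (1024 * a ^ 2 * B ^ 2 * T ^ 2 * (D + F)) = 1)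
    {Y : ℕ → (ℕ → Fin M) → ℝ}
    (hY : ∀ k z, Y k z = if ∀ i < k, Δ (tokenPath g (fun j => a / (j + K₀)) θ₀ z i) ≤ D then
      Real.exp (η * (k + K₀) * pathLyapunov q Δ g H (8 * B * T * F)
        (fun j => a / (j + K₀)) θ₀ k z) else 0) (k : ℕ) :
    DependsOn (Y k) (Set.Iic k) ∧ ∫ ω, Y k (fun j => Z j ω) ∂μ ≤
      Real.exp (η * (3 / 2 * (K₀ * Δ θ₀) + 16 * B * T * F * a) +
        ∑ i ∈ Finset.range k, 1 / ((i : ℝ) + 1)) := by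
  have hdep : ∀ k, DependsOn (Y k) (Set.Iic k) := fun k z z' hz => by
    rw [hY, hY, dependsOn_pathLyapunov q Δ g H _ _ θ₀ k hz]
    have : (∀ i < k, Δ (tokenPath g (fun j => a / (j + K₀)) θ₀ z i) ≤ D) ↔
        ∀ i < k, Δ (tokenPath g (fun j => a / (j + K₀)) θ₀ z' i) ≤ D :=
      forall₂_congr fun i hi => by
        rw [tokenPath_congr g _ θ₀ fun l hl => hz l (Set.mem_Iic.2 (by omega))]
    simp only [this]
  have hK0 := h.le_offset hT ha hK
  refine ⟨hdep k, ?_⟩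
  induction k with
  | zero =>
    have h1 : ∀ z, Y 0 z ≤ Real.exp (η * (3 / 2 * (K₀ * Δ θ₀) + 16 * B * T * F * a)) :=
      fun z => by
        rw [hY, if_pos (by simp), Nat.cast_zero, zero_add, mul_assoc]
        refine Real.exp_le_exp.2 (mul_le_mul_of_nonneg_left ?_ hη.le)
        exact h.offset_mul_pathLyapunov_zero_le hH hT ha hK θ₀ z
    calc _ ≤ ∫ ω, Real.exp (η * (3 / 2 * (K₀ * Δ θ₀) + 16 * B * T * F * a)) ∂μ :=
          integral_mono (integrable_apply_path hZ.1 (hdep 0)) (integrable_const _)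
            fun ω => h1 _
      _ = _ := by simp
  | succ k ih =>
    have hstep : ∫ ω, Y (k + 1) (fun j => Z j ω) ∂μ ≤
        ∫ ω, Real.exp (1 / ((k : ℝ) + 1)) * Y k (fun j => Z j ω) ∂μ := by
      refine integral_apply_path_le hZ (Φ := fun z => Real.exp (1 / ((k : ℝ) + 1)) * Y k z)
        (hdep (k + 1)) (fun z z' hz => by simp only [hdep k hz]) fun z => ?_
      have hiff : ∀ j, (∀ i < k + 1, Δ (tokenPath g (fun j => a / (j + K₀)) θ₀
          (Function.update z (k + 1) j) i) ≤ D) ↔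
          (∀ i < k, Δ (tokenPath g (fun j => a / (j + K₀)) θ₀ z i) ≤ D) ∧
            Δ (tokenPath g (fun j => a / (j + K₀)) θ₀ z k) ≤ D := fun j => by
        have hu : ∀ i < k + 1, tokenPath g (fun j => a / (j + K₀)) θ₀
            (Function.update z (k + 1) j) i = tokenPath g (fun j => a / (j + K₀)) θ₀ z i :=
          fun i hi => tokenPath_update _ _ _ _ hi.le _
        constructor
        · exact fun hl => ⟨fun i hi => hu i (by omega) ▸ hl i (by omega),
            hu k (by omega) ▸ hl k (by omega)⟩
        · rintro ⟨hl, hl'⟩ i hi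
          rw [hu i hi]
          rcases Nat.lt_succ_iff_lt_or_eq.1 hi with hi' | rfl
          exacts [hl i hi', hl']
      simp only [hY, hiff]
      have hcast : ((k + 1 : ℕ) : ℝ) + K₀ = k + K₀ + 1 := by
        push_cast
        ring
      by_cases hk : ∀ i < k, Δ (tokenPath g (fun j => a / (j + K₀)) θ₀ z i) ≤ D
      · by_cases hk' : Δ (tokenPath g (fun j => a / (j + K₀)) θ₀ z k) ≤ D
        · simp only [if_pos (And.intro hk hk'), if_pos hk, hcast]
          refine (h.sum_mul_exp_pathLyapunov_le hP hH hT hHP ha hK θ₀ k z hη hη1 hk').trans ?_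
          rw [← Real.exp_add, add_comm]
          gcongr
          linarith
        · simp only [hk', and_false, if_false, mul_zero, Finset.sum_const_zero]
          positivity
      · simp only [hk, false_and, if_false, mul_zero, Finset.sum_const_zero, le_refl]
    rw [integral_const_mul] at hstep
    refine hstep.trans ((mul_le_mul_of_nonneg_left ih (Real.exp_pos _).le).trans_eq ?_)
    rw [← Real.exp_add, Finset.sum_range_succ]
    congr 1
    ring

/-- The bound with high probability. Each time `k` is allowed to fail with probability
`δ / (k (k + 1))`. As long as no time fails, the bound itself keeps the gap below `D`. -/
theorem le_measureReal_gap_le (hP : P ∈ Matrix.rowStochastic ℝ (Fin M))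
    (hT : IsMixingTime P q T) (ha : 2 ≤ m * a) (hK : 260 * B ^ 2 * T * a ≤ m * K₀)
    (hZ : IsMarkovChain μ P Z) (θ₀ : E) {δ D L : ℝ} (hδ : 0 < δ) (hδ1 : δ < 1)
    (hL : L = 1024 * a ^ 2 * B ^ 2 * T ^ 2 * (D + F)) (hD : 3 * Δ θ₀ + 1 ≤ D)
    (hboot : ∀ k : ℕ, 1 ≤ k →
      32 * B * T * F * a + 10 * L * Real.log (2 * k / δ) ≤ k + K₀) :
    1 - δ ≤ μ.real {ω | ∀ k : ℕ, 1 ≤ k →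
      Δ (tokenPath g (fun j => a / (j + K₀)) θ₀ (fun j => Z j ω) k) ≤
        (3 * (K₀ * Δ θ₀) + (32 * B * T * F * a + 10 * L * Real.log (2 * k / δ))) / (k + K₀)} := by
  classical
  obtain ⟨H, hH, hHP⟩ := exists_poissonKernel hP hT
  have hB := h.one_le
  have hF := h.F_nonneg
  have ha0 := h.stepConst_pos ha
  have hΔ0 := h.gap_nonneg θ₀
  have hK0 := h.le_offset hT.1 ha hK
  have hTpos : (0 : ℝ) < T := by exact_mod_cast hT.1
  have hL0 : 0 < L := by
    rw [hL]
    have : 0 < D + F := by linarith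
    positivity
  have hη1 : L⁻¹ * (1024 * a ^ 2 * B ^ 2 * T ^ 2 * (D + F)) = 1 := by
    rw [← hL, inv_mul_cancel₀ hL0.ne']
  set w := 3 / 2 * (K₀ * Δ θ₀) + 16 * B * T * F * a with hw
  set Y : ℕ → (ℕ → Fin M) → ℝ := fun k z =>
    if ∀ i < k, Δ (tokenPath g (fun j => a / (j + K₀)) θ₀ z i) ≤ D then
      Real.exp (L⁻¹ * (k + K₀) * pathLyapunov q Δ g H (8 * B * T * F)
        (fun j => a / (j + K₀)) θ₀ k z) else 0 with hY
  have hmom := fun k => h.integral_exp_pathLyapunov_le hP hH hT.1 hHP ha hK hZ θ₀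
    (inv_pos.2 hL0) hη1 (Y := Y) (fun _ _ => rfl) k
  have hY0 : ∀ k z, 0 ≤ Y k z := fun k z => by
    simp only [hY]
    split_ifs <;> positivity
  set ℓ : ℕ → ℝ := fun k => Real.log (2 * k / δ) with hℓ
  set t : ℕ → ℝ := fun k => Real.exp (L⁻¹ * w + 1 + 3 * ℓ k) with ht
  set bad : ℕ → Set Ω := fun k => {ω | t (k + 1) ≤ Y (k + 1) fun j => Z j ω} with hbad
  have hbad_meas : ∀ k, MeasurableSet (bad k) := fun k =>
    measurableSet_le measurable_const (measurable_apply_path hZ.1 (hmom (k + 1)).1)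
  have hbad_le : ∀ k, μ.real (bad k) ≤ δ * (1 / ((k : ℝ) + 1) - 1 / (k + 2)) := fun k => by
    have hmarkov := mul_meas_ge_le_integral_of_nonneg (μ := μ)
      (Filter.Eventually.of_forall fun ω => hY0 (k + 1) fun j => Z j ω)
      (integrable_apply_path hZ.1 (hmom (k + 1)).1) (t (k + 1))
    have hint := (hmom (k + 1)).2
    have hk1 : (0 : ℝ) < ((k + 1 : ℕ) : ℝ) := by positivity
    have hexp : Real.exp (L⁻¹ * w + ∑ i ∈ Finset.range (k + 1), 1 / ((i : ℝ) + 1)) ≤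
        t (k + 1) * (((k + 1 : ℕ) : ℝ) / (2 * ((k + 1 : ℕ) : ℝ) / δ) ^ 3) := by
      -- `t` is a deviation of `3 ℓ` above the exponent of the moment bound, apart from `log k`
      have hℓexp : (2 * ((k + 1 : ℕ) : ℝ) / δ) = Real.exp (ℓ (k + 1)) :=
        (Real.exp_log (by positivity)).symm
      rw [hℓexp, ← Real.exp_nat_mul]
      nth_rewrite 1 [← Real.exp_log hk1]
      rw [← Real.exp_sub, ht, ← Real.exp_add]
      refine Real.exp_le_exp.2 ?_
      have := sum_range_one_div_le (k + 1)
      push_cast at this ⊢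
      linarith
    have h1 := le_of_mul_le_mul_left ((hmarkov.trans hint).trans hexp) (Real.exp_pos _)
    refine h1.trans ?_
    push_cast
    have hk : (0 : ℝ) ≤ k := k.cast_nonneg
    have e1 : ((k : ℝ) + 1) / (2 * (k + 1) / δ) ^ 3 = δ * (δ ^ 2 / (8 * (k + 1) ^ 2)) := by
      field_simp
      ring
    have e2 : 1 / ((k : ℝ) + 1) - 1 / (k + 2) = 1 / ((k + 1) * (k + 2)) := by
      field_simp
      ring
    rw [e1, e2]
    gcongr δ * ?_
    refine div_le_div₀ zero_le_one ?_ (by positivity) ?_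
    · nlinarith
    · nlinarith
  have hsum : ∀ n : ℕ, ∑ k ∈ Finset.range n, δ * (1 / ((k : ℝ) + 1) - 1 / (k + 2)) =
      δ * (1 - 1 / (n + 1)) := fun n => by
    induction n with
    | zero => simp
    | succ n ih =>
      rw [Finset.sum_range_succ, ih]
      push_cast
      ring
  have hunion : μ (⋃ k, bad k) ≤ ENNReal.ofReal δ := by
    refine (measure_iUnion_le _).trans (ENNReal.tsum_le_of_sum_range_le fun n => ?_)
    calc ∑ k ∈ Finset.range n, μ (bad k) =
            ENNReal.ofReal (∑ k ∈ Finset.range n, μ.real (bad k)) := by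
          rw [ENNReal.ofReal_sum_of_nonneg fun _ _ => measureReal_nonneg]
          exact Finset.sum_congr rfl fun k _ => (ofReal_measureReal).symm
      _ ≤ ENNReal.ofReal δ := by
          refine ENNReal.ofReal_le_ofReal ((Finset.sum_le_sum fun k _ => hbad_le k).trans ?_)
          rw [hsum]
          have : 0 ≤ 1 / ((n : ℝ) + 1) := by positivity
          nlinarith
  have hgood : 1 - δ ≤ μ.real (⋃ k, bad k)ᶜ := by
    rw [probReal_compl_eq_one_sub (MeasurableSet.iUnion hbad_meas)]
    have := ENNReal.toReal_le_of_le_ofReal hδ.le hunion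
    rw [measureReal_def]
    linarith
  refine hgood.trans (measureReal_mono fun ω hω => ?_)
  have hω' : ∀ k, Y (k + 1) (fun j => Z j ω) < t (k + 1) := fun k => by
    by_contra! hk
    exact hω (Set.mem_iUnion.2 ⟨k, hk⟩)
  -- off the bad events, the bound at time `k` holds if all earlier gaps are at most `D` ...
  have hbound : ∀ k : ℕ, 1 ≤ k →
      (∀ i < k, Δ (tokenPath g (fun j => a / (j + K₀)) θ₀ (fun j => Z j ω) i) ≤ D) →
      Δ (tokenPath g (fun j => a / (j + K₀)) θ₀ (fun j => Z j ω) k) ≤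
        (3 * (K₀ * Δ θ₀) + (32 * B * T * F * a + 10 * L * Real.log (2 * k / δ))) / (k + K₀) := by
    intro k hk1 hk
    obtain ⟨k, rfl⟩ := Nat.exists_eq_add_of_le' hk1
    have h1 := hω' k
    simp only [hY, if_pos hk, ht] at h1
    have h2 := Real.exp_lt_exp.1 h1
    have hΔW := h.gap_le_pathLyapunov hH hT.1 ha hK θ₀ (k + 1) fun j => Z j ω
    set W := pathLyapunov q Δ g H (8 * B * T * F) (fun j => a / (j + K₀)) θ₀ (k + 1)
      fun j => Z j ω
    have hs : 0 < ((k + 1 : ℕ) : ℝ) + K₀ := by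
      have : (0 : ℝ) ≤ ((k + 1 : ℕ) : ℝ) := Nat.cast_nonneg _
      linarith
    have hℓ2 : 1 / 2 ≤ ℓ (k + 1) := by
      have h3 : Real.log 2 ≤ ℓ (k + 1) := by
        refine Real.log_le_log (by norm_num) ?_
        rw [le_div_iff₀ hδ]
        have : (1 : ℝ) ≤ ((k + 1 : ℕ) : ℝ) := by exact_mod_cast hk1
        nlinarith
      linarith [Real.log_two_gt_d9]
    have h4 : (((k + 1 : ℕ) : ℝ) + K₀) * W ≤ w + 5 * L * ℓ (k + 1) := by
      have h5 : L⁻¹ * (((k + 1 : ℕ) : ℝ) + K₀) * W ≤ L⁻¹ * w + 5 * ℓ (k + 1) := by linarith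
      calc _ = L * (L⁻¹ * (((k + 1 : ℕ) : ℝ) + K₀) * W) := by field_simp
        _ ≤ L * (L⁻¹ * w + 5 * ℓ (k + 1)) := by gcongr
        _ = _ := by field_simp
    rw [le_div_iff₀ hs]
    have h6 := mul_le_mul_of_nonneg_right hΔW hs.le
    linarith
  -- ... and, by the assumption on `K₀`, it keeps the gap at time `k` below `D` as well
  have hall : ∀ k : ℕ, ∀ i < k,
      Δ (tokenPath g (fun j => a / (j + K₀)) θ₀ (fun j => Z j ω) i) ≤ D := by
    intro k
    induction k with
    | zero => simp
    | succ k ih =>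
      intro i hi
      rcases Nat.lt_succ_iff_lt_or_eq.1 hi with hi' | rfl
      · exact ih i hi'
      rcases Nat.eq_zero_or_pos i with rfl | hi0
      · rw [tokenPath]
        linarith
      · have hi1 : (0 : ℝ) ≤ i := i.cast_nonneg
        refine (hbound i hi0 ih).trans ?_
        rw [div_le_iff₀ (by linarith)]
        have h1 := hboot i hi0
        have h2 : (3 * Δ θ₀ + 1) * (i + K₀) ≤ D * (i + K₀) := by gcongr
        have h3 : 0 ≤ Δ θ₀ * i := by positivity
        linarith
  exact fun k hk => hbound k hk (hall k)

end IsGradientOracle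
end HighProbability

/-! ### Constants in terms of the curvature -/

section LogBounds

/-- The logarithmic growth in `k` is dominated by `k` itself, up to a constant. -/
theorem mul_log_div_le_add {y δ k : ℝ} (hy : 0 < y) (hδ : 0 < δ) (hk : 0 < k) :
    y * Real.log (2 * k / δ) ≤ k + y * Real.log (2 * y / δ) := by
  have h1 : 2 * k / δ = k / y * (2 * y / δ) := by field_simp
  have h2 : Real.log (k / y) ≤ k / y :=
    (Real.log_le_sub_one_of_pos (by positivity)).trans (by linarith)
  have h3 : y * (k / y) = k := by field_simp
  rw [h1, Real.log_mul (by positivity) (by positivity), mul_add]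
  have := mul_le_mul_of_nonneg_left h2 hy.le
  linarith

theorem half_le_log_two_add {x : ℝ} (hx : 0 ≤ x) : 1 / 2 ≤ Real.log (2 + x) := by
  have : Real.log 2 ≤ Real.log (2 + x) := Real.log_le_log two_pos (by linarith)
  linarith [Real.log_two_gt_d9]

theorem log_mul_div_le {c S δ : ℝ} (hc : 0 < c) (hS : 0 < S) (hδ : 0 < δ) :
    Real.log (2 * (c * S) / δ) ≤ (4 * c + 1) * Real.log (2 + S / δ) := by
  have h1 : 2 * (c * S) / δ = 2 * c * (S / δ) := by ring
  have hx : 0 < S / δ := by positivity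
  have h2 : Real.log (2 * c) ≤ 2 * c :=
    (Real.log_le_sub_one_of_pos (by positivity)).trans (by linarith)
  have h3 : Real.log (S / δ) ≤ Real.log (2 + S / δ) := Real.log_le_log hx (by linarith)
  have h4 := half_le_log_two_add hx.le
  rw [h1, Real.log_mul (by positivity) hx.ne']
  nlinarith

/-- Bernoulli's inequality `(1 / δ) ^ p ≤ 1 + p (1 / δ - 1)` with the exponent `p = min S 1`. -/
theorem min_mul_log_le {S δ : ℝ} (hS : 0 < S) (hδ : 0 < δ) (hδ1 : δ < 1) :
    min S 1 * Real.log (1 / δ) ≤ Real.log (2 + S / δ) := by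
  have hp : 0 < min S 1 := lt_min hS one_pos
  have h1 : 1 ≤ 1 / δ := by rw [le_div_iff₀ hδ]; linarith
  have h2 := rpow_one_add_le_one_add_mul_self (s := 1 / δ - 1) (by linarith) hp.le
    (min_le_right S 1)
  rw [add_sub_cancel] at h2
  rw [← Real.log_rpow (by positivity)]
  refine Real.log_le_log (by positivity) (h2.trans ?_)
  have h3 : min S 1 * (1 / δ - 1) ≤ S * (1 / δ - 1) :=
    mul_le_mul_of_nonneg_right (min_le_left S 1) (by linarith)
  rw [div_eq_mul_one_div S δ]
  nlinarith

end LogBounds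

section Constants

/-- The coefficient of `T² log (2 k / δ) / m²` in the bound with high probability. -/
def tailConst (B F D R : ℝ) : ℝ := 64 * R * B ^ 2 * F + 10240 * R ^ 2 * B ^ 2 * (D + F)

/-- The coefficient in the lower bound on the offset required with high probability. -/
def offsetConst (B F D R : ℝ) : ℝ :=
  520 * B ^ 2 * R + tailConst B F D R * (4 * tailConst B F D R + 1)

/-- The coefficient of `T / m²` in the bound in expectation. -/
def meanConst (B F R : ℝ) : ℝ := 32 * R * B ^ 2 * F + 130 * B ^ 2 * R ^ 2 * F

variable {M : ℕ} {E : Type*} [NormedAddCommGroup E] [InnerProductSpace ℝ E]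
  {q : Fin M → ℝ} {Δ : E → ℝ} {g : Fin M → E → E} {B F m D R : ℝ}
  {T : ℕ} {P : Matrix (Fin M) (Fin M) ℝ} {a K₀ : ℝ}
  {Ω : Type*} [MeasurableSpace Ω] {μ : Measure Ω} [IsProbabilityMeasure μ]
  {Z : ℕ → Ω → Fin M}

theorem tailConst_pos (hB : 1 ≤ B) (hF : 0 ≤ F) (hD : 1 ≤ D) (hR : 1 ≤ R) :
    0 < tailConst B F D R := by
  rw [tailConst]
  positivity

namespace IsGradientOracle

variable (h : IsGradientOracle q Δ g B F m)
include h

theorem stepConst_le (hR : 1 ≤ R) (haR : a ≤ R / m) : a ≤ R * B * (1 / m ^ 2) := by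
  have hm := h.m_pos
  calc a ≤ R / m := haR
    _ = R * m * (1 / m ^ 2) := by field_simp
    _ ≤ _ := by gcongr; exact h.m_le

theorem offset_condition (haR : a ≤ R / m)
    (hK : 260 * B ^ 2 * R * (T / m ^ 2) ≤ K₀) : 260 * B ^ 2 * T * a ≤ m * K₀ := by
  have hm := h.m_pos
  have hB := h.one_le
  calc 260 * B ^ 2 * T * a ≤ 260 * B ^ 2 * T * (R / m) := by gcongr
    _ = m * (260 * B ^ 2 * R * (T / m ^ 2)) := by field_simp
    _ ≤ m * K₀ := by gcongr

theorem integral_gap_le_meanConst (hP : P ∈ Matrix.rowStochastic ℝ (Fin M))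
    (hT : IsMixingTime P q T) (hR : 1 ≤ R) (ha : 2 ≤ m * a) (haR : a ≤ R / m)
    (hK : 260 * B ^ 2 * R * (T / m ^ 2) ≤ K₀) (hZ : IsMarkovChain μ P Z) (θ₀ : E) (k : ℕ) :
    ∫ ω, Δ (tokenPath g (fun j => a / (j + K₀)) θ₀ (fun j => Z j ω) k) ∂μ ≤
      (3 * (K₀ * Δ θ₀) + meanConst B F R * (T / m ^ 2)) / (k + K₀) := by
  have hK' := h.offset_condition haR hK
  have hm := h.m_pos
  have hB := h.one_le
  have hF := h.F_nonneg
  have ha0 := h.stepConst_pos ha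
  have hK0 := h.le_offset hT.1 ha hK'
  refine (h.integral_gap_le hP hT ha hK' hZ θ₀ k).trans ?_
  have h1 : 32 * B * T * F * a ≤ 32 * R * B ^ 2 * F * (T / m ^ 2) := by
    calc 32 * B * T * F * a ≤ 32 * B * T * F * (R * B * (1 / m ^ 2)) := by
          gcongr
          exact h.stepConst_le hR haR
      _ = _ := by ring
  have h2 : 130 * B ^ 2 * T * F * a ^ 2 ≤ 130 * B ^ 2 * R ^ 2 * F * (T / m ^ 2) := by
    calc 130 * B ^ 2 * T * F * a ^ 2 ≤ 130 * B ^ 2 * T * F * (R / m) ^ 2 := by gcongr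
      _ = _ := by ring
  rw [meanConst]
  gcongr ?_ / _
  linarith

theorem le_measureReal_gap_le_tailConst (hP : P ∈ Matrix.rowStochastic ℝ (Fin M))
    (hT : IsMixingTime P q T) (hR : 1 ≤ R) (ha : 2 ≤ m * a) (haR : a ≤ R / m) (θ₀ : E)
    (hD : 3 * Δ θ₀ + 1 ≤ D) {δ : ℝ} (hδ : 0 < δ) (hδ1 : δ < 1)
    (hK : offsetConst B F D R * (T ^ 2 / m ^ 2) * Real.log (2 + T ^ 2 / m ^ 2 / δ) ≤ K₀)
    (hZ : IsMarkovChain μ P Z) :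
    1 - δ ≤ μ.real {ω | ∀ k : ℕ, 1 ≤ k →
      Δ (tokenPath g (fun j => a / (j + K₀)) θ₀ (fun j => Z j ω) k) ≤
        (3 * (K₀ * Δ θ₀) + tailConst B F D R * (T ^ 2 / m ^ 2 * Real.log (2 * k / δ))) /
          (k + K₀)} := by
  have hm := h.m_pos
  have hB := h.one_le
  have hF := h.F_nonneg
  have hD1 : 1 ≤ D := by linarith [h.gap_nonneg θ₀]
  have ha0 := h.stepConst_pos ha
  have hT1 : (1 : ℝ) ≤ T := by exact_mod_cast hT.1
  have hTT : (T : ℝ) ≤ T ^ 2 := by nlinarith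
  have hc := tailConst_pos hB hF hD1 hR
  set c := tailConst B F D R with hcdef
  set S : ℝ := T ^ 2 / m ^ 2 with hS
  have hS0 : 0 < S := by positivity
  have hTS : T / m ^ 2 ≤ S := by rw [hS]; gcongr
  have hlog := half_le_log_two_add (x := S / δ) (by positivity)
  rw [offsetConst, ← hcdef] at hK
  have hK1 : 260 * B ^ 2 * R * (T / m ^ 2) ≤ K₀ := by
    calc 260 * B ^ 2 * R * (T / m ^ 2) ≤ 260 * B ^ 2 * R * S := by gcongr
      _ = 520 * B ^ 2 * R * S * (1 / 2) := by ring
      _ ≤ (520 * B ^ 2 * R + c * (4 * c + 1)) * S * Real.log (2 + S / δ) := by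
          gcongr
          exact le_add_of_nonneg_right (by positivity)
      _ ≤ K₀ := hK
  have hK2 : c * S * Real.log (2 * (c * S) / δ) ≤ K₀ := by
    calc c * S * Real.log (2 * (c * S) / δ) ≤ c * S * ((4 * c + 1) * Real.log (2 + S / δ)) := by
          gcongr
          exact log_mul_div_le hc hS0 hδ
      _ = c * (4 * c + 1) * S * Real.log (2 + S / δ) := by ring
      _ ≤ (520 * B ^ 2 * R + c * (4 * c + 1)) * S * Real.log (2 + S / δ) := by
          gcongr
          exact le_add_of_nonneg_left (by positivity)
      _ ≤ K₀ := hK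
  have hK' := h.offset_condition haR hK1
  have hK0 := h.le_offset hT.1 ha hK'
  have hterm : ∀ k : ℕ, 1 ≤ k → 32 * B * T * F * a +
      10 * (1024 * a ^ 2 * B ^ 2 * T ^ 2 * (D + F)) * Real.log (2 * k / δ) ≤
        c * (S * Real.log (2 * k / δ)) := fun k hk => by
    have hk' : (1 : ℝ) ≤ k := by exact_mod_cast hk
    have hℓ : 1 / 2 ≤ Real.log (2 * k / δ) := by
      have h1 : 2 * k / δ = 2 + (2 * k / δ - 2) := by ring
      rw [h1]
      refine half_le_log_two_add ?_
      rw [sub_nonneg, le_div_iff₀ hδ]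
      nlinarith
    set ℓ := Real.log (2 * k / δ)
    have h1 : 32 * B * T * F * a ≤ 64 * R * B ^ 2 * F * (S * ℓ) := by
      calc 32 * B * T * F * a ≤ 32 * B * T * F * (R * B * (1 / m ^ 2)) := by
            gcongr
            exact h.stepConst_le hR haR
        _ = 64 * R * B ^ 2 * F * (T / m ^ 2 * (1 / 2)) := by ring
        _ ≤ _ := by gcongr
    have h2 : 10 * (1024 * a ^ 2 * B ^ 2 * T ^ 2 * (D + F)) * ℓ ≤
        10240 * R ^ 2 * B ^ 2 * (D + F) * (S * ℓ) := by
      calc 10 * (1024 * a ^ 2 * B ^ 2 * T ^ 2 * (D + F)) * ℓ ≤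
            10 * (1024 * (R / m) ^ 2 * B ^ 2 * T ^ 2 * (D + F)) * ℓ := by gcongr
        _ = _ := by
            rw [hS]
            ring
    rw [hcdef, tailConst]
    linarith
  refine (h.le_measureReal_gap_le hP hT ha hK' hZ θ₀ hδ hδ1 rfl hD fun k hk => ?_).trans
    (measureReal_mono fun ω hω k hk => (hω k hk).trans ?_)
  · have hk' : (0 : ℝ) < k := by exact_mod_cast hk
    have h1 := mul_log_div_le_add (y := c * S) (by positivity) hδ hk'
    linarith [hterm k hk]
  · have hk' : (0 : ℝ) < k := by exact_mod_cast hk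
    gcongr ?_ / _
    linarith [hterm k hk]

end IsGradientOracle

end Constants

end TokenSGD

theorem mainTheorem4 (B F D R : ℝ) :
    ∃ C : ℝ, 0 < C ∧
      ∀ (M d : ℕ) (n : Fin M → ℕ)
        (A : ∀ i, Matrix (Fin (n i)) (Fin d) ℝ) (b : ∀ i, EuclideanSpace ℝ (Fin (n i)))
        (θ₀ : EuclideanSpace ℝ (Fin d)) (a : ℝ)
        (P : Matrix (Fin M) (Fin M) ℝ) (T : ℕ) (N σ : ℝ),
        (∀ i, 1 ≤ n i) →
        TokenSGD.stackMatrix A ≠ 0 →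
        N = ∑ i, (n i : ℝ) →
        σ = TokenSGD.sigmaMin (TokenSGD.stackMatrix A) →
        2 * N / σ ^ 2 ≤ a →
        P ∈ Matrix.rowStochastic ℝ (Fin M) →
        (∀ q, TokenSGD.IsInvariant P q ↔ q = TokenSGD.agentDist n) →
        TokenSGD.IsMixingTime P (TokenSGD.agentDist n) T →
        -- the quantities on which the constant `C` may depend
        (∀ i, 2 * N * TokenSGD.sigmaMax (A i) ^ 2 / (n i : ℝ) ^ 2 ≤ B) →
        TokenSGD.optValue A b ≤ F →
        TokenSGD.gap A b θ₀ ≤ D →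
        a ≤ R * (N / σ ^ 2) →
        -- (a) the high-probability bound, uniform in time
        (∃ 𝔞₁ : ℝ → ℝ,
          (∃ c : ℝ, 0 < c ∧ ∀ δ : ℝ, 0 < δ → δ < 1 → c * Real.log (1 / δ) ≤ 𝔞₁ δ) ∧
          (∀ δ : ℝ, 0 < δ → δ < 1 →
            𝔞₁ δ ≤ C * (T ^ 2 * N ^ 2 / σ ^ 4) *
              Real.log (2 + (T ^ 2 * N ^ 2 / σ ^ 4) / δ)) ∧
          ∀ (δ K₀ : ℝ), 0 < δ → δ < 1 → 𝔞₁ δ < K₀ →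
            ∀ (Ω : Type*) [MeasurableSpace Ω] (μ : MeasureTheory.Measure Ω)
              [MeasureTheory.IsProbabilityMeasure μ] (Z : ℕ → Ω → Fin M),
              TokenSGD.IsMarkovChain μ P Z →
              1 - δ ≤ μ.real {ω | ∀ k : ℕ, 1 ≤ k →
                TokenSGD.gap A b
                    (TokenSGD.iterate A b (fun j => a / (j + K₀)) θ₀ (fun j => Z j ω) k) ≤
                  C * (K₀ * TokenSGD.gap A b θ₀ +
                    T ^ 2 * N ^ 2 * Real.log (2 * k / δ) / σ ^ 4) / (k + K₀)}) ∧
        -- (b) the bound in expectation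
        (∃ 𝔞₂ : ℝ, 0 < 𝔞₂ ∧ 𝔞₂ ≤ C * (T * N ^ 2 / σ ^ 4) ∧
          ∀ K₀ : ℝ, 𝔞₂ < K₀ →
            ∀ (Ω : Type*) [MeasurableSpace Ω] (μ : MeasureTheory.Measure Ω)
              [MeasureTheory.IsProbabilityMeasure μ] (Z : ℕ → Ω → Fin M),
              TokenSGD.IsMarkovChain μ P Z →
              ∀ k : ℕ, 1 ≤ k →
                MeasureTheory.Integrable (fun ω => TokenSGD.gap A b
                  (TokenSGD.iterate A b (fun j => a / (j + K₀)) θ₀ (fun j => Z j ω) k)) μ ∧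
                ∫ ω, TokenSGD.gap A b
                    (TokenSGD.iterate A b (fun j => a / (j + K₀)) θ₀ (fun j => Z j ω) k) ∂μ ≤
                  C * (K₀ * TokenSGD.gap A b θ₀ + T * N ^ 2 / σ ^ 4) / (k + K₀)) := by
  -- the analysis needs `1 ≤ B`, `0 ≤ F` and `1 ≤ R`; `D'` bounds the gap with high probability
  set B' := max B 1 with hB'
  set F' := max F 0 with hF'
  set D' := 3 * max D 0 + 1 with hD'
  set R' := max R 1 with hR'
  have hB1 : 1 ≤ B' := le_max_right _ _
  have hF0 : 0 ≤ F' := le_max_right _ _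
  have hD0 : 0 ≤ max D 0 := le_max_right _ _
  have hD1 : 1 ≤ D' := by linarith
  have hR1 : 1 ≤ R' := le_max_right _ _
  have htail := TokenSGD.tailConst_pos hB1 hF0 hD1 hR1
  set c₁ := TokenSGD.tailConst B' F' D' R'
  set c₂ := TokenSGD.offsetConst B' F' D' R' with hc₂
  set c₃ := TokenSGD.meanConst B' F' R' with hc₃
  have hc₃0 : 0 ≤ c₃ := by
    rw [hc₃, TokenSGD.meanConst]
    positivity
  have hc₂0 : 520 * B' ^ 2 * R' + c₁ ≤ c₂ := by
    rw [hc₂, TokenSGD.offsetConst]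
    nlinarith
  have hc₂1 : 0 < 260 * B' ^ 2 * R' := by positivity
  refine ⟨c₂ + c₃ + 3, by linarith, ?_⟩
  intro M d n A b θ₀ a P T N σ hn hA hN hσ ha hP _ hT hB hF hD haR
  have hσ0 : 0 < σ := hσ ▸ TokenSGD.sigmaMin_pos hA
  have hN0 : 0 < N := by
    rw [hN]
    have hM : Nonempty (Fin M) := by
      by_contra hM
      rw [not_nonempty_iff] at hM
      exact hA (Matrix.ext fun r => isEmptyElim r.1)
    exact Finset.sum_pos (fun i _ => by exact_mod_cast hn i) Finset.univ_nonempty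
  have h := TokenSGD.isGradientOracle_leastSquares (b := b) (F := F') hn hA hN
    (fun i => (hB i).trans (le_max_left B 1)) hB1 (hF.trans (le_max_left F 0)) hN0
  rw [← hσ] at h
  set m := σ ^ 2 / N with hm
  have hm0 : 0 < m := h.m_pos
  have ha' : 2 ≤ m * a := by
    calc 2 = m * (2 * N / σ ^ 2) := by rw [hm]; field_simp
      _ ≤ m * a := by gcongr
  have haR' : a ≤ R' / m := by
    calc a ≤ R * (N / σ ^ 2) := haR
      _ ≤ R' * (N / σ ^ 2) := by gcongr; exact le_max_left _ _
      _ = R' / m := by rw [hm]; field_simp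
  have hgap0 := h.gap_nonneg θ₀
  have hDθ : 3 * TokenSGD.gap A b θ₀ + 1 ≤ D' := by
    linarith [hD.trans (le_max_left D 0)]
  have hT1 : (0 : ℝ) < T := by exact_mod_cast hT.1
  -- the curvature `m` turns `N ^ 2 / σ ^ 4` into `1 / m ^ 2`
  have hS : (T : ℝ) ^ 2 * N ^ 2 / σ ^ 4 = T ^ 2 / m ^ 2 := by rw [hm]; field_simp
  have hS₁ : (T : ℝ) * N ^ 2 / σ ^ 4 = T / m ^ 2 := by rw [hm]; field_simp
  have hSlog : ∀ x : ℝ, (T : ℝ) ^ 2 * N ^ 2 * x / σ ^ 4 = T ^ 2 / m ^ 2 * x := fun x => by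
    rw [← hS]
    ring
  simp only [TokenSGD.iterate_eq_tokenPath, hSlog]
  rw [hS, hS₁]
  have hS0 : (0 : ℝ) < T ^ 2 / m ^ 2 := by positivity
  have hS₁0 : (0 : ℝ) < T / m ^ 2 := by positivity
  refine ⟨⟨fun δ => c₂ * (T ^ 2 / m ^ 2) * Real.log (2 + T ^ 2 / m ^ 2 / δ),
    ⟨c₂ * (T ^ 2 / m ^ 2) * min (T ^ 2 / m ^ 2) 1,
      mul_pos (mul_pos (by linarith) hS0) (lt_min hS0 one_pos), fun δ hδ hδ1 => ?_⟩,
    fun δ hδ hδ1 => ?_, fun δ K₀ hδ hδ1 hK Ω _ μ _ Z hZ => ?_⟩,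
    260 * B' ^ 2 * R' * (T / m ^ 2), by positivity, ?_, fun K₀ hK Ω _ μ _ Z hZ k hk => ⟨?_, ?_⟩⟩
  · rw [mul_assoc]
    exact mul_le_mul_of_nonneg_left (TokenSGD.min_mul_log_le hS0 hδ hδ1)
      (mul_pos (by linarith) hS0).le
  · have := TokenSGD.half_le_log_two_add (x := T ^ 2 / m ^ 2 / δ) (by positivity)
    gcongr ?_ * _ * _
    linarith
  · refine (h.le_measureReal_gap_le_tailConst hP hT hR1 ha' haR' θ₀ hDθ hδ hδ1 hK.le hZ).trans
      (MeasureTheory.measureReal_mono fun ω hω k hk => (hω k hk).trans ?_)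
    have hK0 : 0 < K₀ := by
      refine lt_trans ?_ hK
      have := TokenSGD.half_le_log_two_add (x := T ^ 2 / m ^ 2 / δ) (by positivity)
      exact mul_pos (mul_pos (by linarith) hS0) (by linarith)
    have hk' : (1 : ℝ) ≤ k := by exact_mod_cast hk
    have hℓ : 0 ≤ Real.log (2 * k / δ) := by
      refine Real.log_nonneg ?_
      rw [le_div_iff₀ hδ]
      linarith
    gcongr ?_ / _
    rw [mul_add]
    gcongr <;> linarith
  · gcongr
    linarith
  · exact TokenSGD.integrable_apply_path hZ.1 (TokenSGD.dependsOn_gap_tokenPath _ _ _ _ k)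
  · refine (h.integral_gap_le_meanConst hP hT hR1 ha' haR' hK.le hZ θ₀ k).trans ?_
    have hK0 : 0 < K₀ := lt_trans (by positivity) hK
    gcongr ?_ / _
    rw [mul_add]
    gcongr <;> linarith
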